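/- Let $X$ be a compact connected (Hausdorff) abelian group of finite topological dimension $d$, let $m$ be its normalized Haar measure and let $\mathcal B$ be the completion of the Borel $\sigma$-algebra of $X$. A finite set $F$, $|F|>1$, of epimorphisms (continuous surjective endomorphisms) of $X$ is called *mixing* if for every family of sets $B_\gamma\in\mathcal B$, $\gamma\in F$, $$m\Big(\bigcap_{\gamma\in F}\gamma^{-n}(B_\gamma)\Big)\longrightarrow\prod_{\gamma\in F}m(B_\gamma)\qquad\text{as } n\to\infty .$$ The character group $\hat X$ is torsion free of rank $d$; for an epimorphism $T$ of $X$ let $\hat T$ denote the (invertible) linear map of $\hat X\otimes_{\mathbb Z}\mathbb Q\cong\mathbb Q^d$ extending $\chi\mapsto\chi\circ T$. Let $s\ge 2$ and let $T_1,\dots,T_s$ be distinct, pairwise commuting epimorphisms of $X$. Then the following statements are equivalent: (a) the set $\{T_1,\dots,T_s\}$ is mixing; (b) for every $i\ne j$, the set $\{T_i,T_j\}$ is mixing; (c) for every $i\ne j$, no root of unity is a (complex) eigenvalue of the linear map $\hat T_i^{-1}\hat T_j$. -/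

import Mathlib

open Set Filter Topology MeasureTheory TopologicalSpace
open scoped TensorProduct

/-- `X` has Lebesgue covering dimension at most `d`: every finite open cover has a finite open
refinement such that no point lies in more than `d + 1` of its members. -/
def CoveringDimLE (X : Type*) [TopologicalSpace X] (d : ℕ) : Prop :=
  ∀ 𝒰 : Set (Set X), 𝒰.Finite → (∀ U ∈ 𝒰, IsOpen U) → ⋃₀ 𝒰 = univ →
    ∃ 𝒱 : Set (Set X), 𝒱.Finite ∧ (∀ V ∈ 𝒱, IsOpen V) ∧ ⋃₀ 𝒱 = univ ∧
      (∀ V ∈ 𝒱, ∃ U ∈ 𝒰, V ⊆ U) ∧ ∀ x : X, {V ∈ 𝒱 | x ∈ V}.ncard ≤ d + 1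

/-- `X` is finite-dimensional, in the sense of Lebesgue covering dimension. -/
def FiniteCoveringDim (X : Type*) [TopologicalSpace X] : Prop :=
  ∃ d : ℕ, CoveringDimLE X d

section Mixing

variable (X : Type*) [TopologicalSpace X] [CommGroup X] [IsTopologicalGroup X] [CompactSpace X]
  [MeasurableSpace X] [BorelSpace X]

/-- The Haar measure of a compact group `X`, normalized by `m(X) = 1`. -/
noncomputable def normalizedHaar : Measure X :=
  Measure.haarMeasure (⊤ : PositiveCompacts X)

variable {X}

/-- A finite set `F` of at least two continuous endomorphisms of `X` is mixing if
`m (⋂ γ ∈ F, γ⁻ⁿ (B γ)) → ∏ γ ∈ F, m (B γ)` as `n → ∞`, for all sets `B γ` that are measurable with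
respect to the completion of the Borel σ-algebra (the null-measurable sets). -/
def IsMixing (F : Finset (X →ₜ* X)) : Prop :=
  1 < F.card ∧
    ∀ B : (X →ₜ* X) → Set X, (∀ γ ∈ F, NullMeasurableSet (B γ) (normalizedHaar X)) →
      Tendsto (fun n : ℕ => normalizedHaar X (⋂ γ ∈ F, (γ : X → X)^[n] ⁻¹' B γ)) atTop
        (𝓝 (∏ γ ∈ F, normalizedHaar X (B γ)))

end Mixing

section Dual

variable (X : Type*) [TopologicalSpace X] [CommGroup X]

/-- The rational vector space `ℚ ⊗ X̂`, where `X̂` is the character group of `X`. When `X̂` is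
torsion free of rank `d` it is isomorphic to `ℚ^d` and contains `X̂` as a full-rank subgroup. -/
abbrev RatDual : Type _ := ℚ ⊗[ℤ] Additive (PontryaginDual X)

variable {X}

/-- The endomorphism `χ ↦ χ ∘ T` of the character group of `X`, written additively. -/
noncomputable def charMap (T : X →ₜ* X) :
    Additive (PontryaginDual X) →ₗ[ℤ] Additive (PontryaginDual X) :=
  (MonoidHom.toAdditive (PontryaginDual.map T).toMonoidHom).toIntLinearMap

/-- The `ℚ`-linear extension `T̂` of `χ ↦ χ ∘ T` to `ℚ ⊗ X̂`. -/
noncomputable def hatMap (T : X →ₜ* X) : Module.End ℚ (RatDual X) :=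
  (charMap T).baseChange ℚ

/-- For a surjective endomorphism `T`, the linear map `T̂` is invertible when `ℚ ⊗ X̂` is
finite-dimensional. -/
theorem isUnit_hatMap [FiniteDimensional ℚ (RatDual X)] (T : X →ₜ* X)
    (hT : Function.Surjective T) : IsUnit (hatMap T) := by
  have h1 : Function.Injective (charMap T) := by
    intro χ ψ h
    have h' : PontryaginDual.map T χ.toMul = PontryaginDual.map T ψ.toMul := h
    have : χ.toMul = ψ.toMul := by
      ext y
      obtain ⟨x, rfl⟩ := hT y
      rw [← PontryaginDual.map_apply, h', PontryaginDual.map_apply]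
    exact this
  have h2 : Function.Injective (hatMap T) :=
    Module.Flat.lTensor_preserves_injective_linearMap (M := ℚ) (charMap T) h1
  rw [LinearMap.isUnit_iff_ker_eq_bot]
  exact LinearMap.ker_eq_bot.mpr h2

end Dual

/-- `ζ : ℂ` is an eigenvalue of `A⁻¹ B`, for endomorphisms `A` and `B` of a rational vector space:
there is a nonzero complex vector `v` such that `A⁻¹ B v = ζ v`, that is, `B v = ζ A v`
(see `hasEigenvalueInvMul_iff` for the agreement with the eigenvalues of the linear map `A⁻¹ B`). -/
def HasEigenvalueInvMul {V : Type*} [AddCommGroup V] [Module ℚ V] (A B : Module.End ℚ V) (ζ : ℂ) :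
    Prop :=
  ∃ v : ℂ ⊗[ℚ] V, v ≠ 0 ∧ B.baseChange ℂ v = ζ • A.baseChange ℂ v

theorem hasEigenvalueInvMul_iff {V : Type*} [AddCommGroup V] [Module ℚ V]
    (A : (Module.End ℚ V)ˣ) (B : Module.End ℚ V) (ζ : ℂ) :
    HasEigenvalueInvMul (A : Module.End ℚ V) B ζ ↔
      Module.End.HasEigenvalue
        (LinearMap.baseChange ℂ ((↑A⁻¹ : Module.End ℚ V) * B) : Module.End ℂ (ℂ ⊗[ℚ] V)) ζ := by
  have hl : ∀ v : ℂ ⊗[ℚ] V, (↑A⁻¹ : Module.End ℚ V).baseChange ℂ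
      ((A : Module.End ℚ V).baseChange ℂ v) = v := by
    intro v
    rw [← Module.End.mul_apply, ← LinearMap.baseChange_mul, Units.inv_mul]
    simp
  have hr : ∀ v : ℂ ⊗[ℚ] V, (A : Module.End ℚ V).baseChange ℂ
      ((↑A⁻¹ : Module.End ℚ V).baseChange ℂ v) = v := by
    intro v
    rw [← Module.End.mul_apply, ← LinearMap.baseChange_mul, Units.mul_inv]
    simp
  rw [LinearMap.baseChange_mul]
  constructor
  · rintro ⟨v, hv, h⟩
    refine Module.End.hasEigenvalue_of_hasEigenvector (x := v)
      ⟨Module.End.mem_eigenspace_iff.mpr ?_, hv⟩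
    rw [Module.End.mul_apply, h, map_smul, hl]
  · intro h
    obtain ⟨v, hv⟩ := h.exists_hasEigenvector
    refine ⟨v, hv.2, ?_⟩
    rw [← map_smul, ← hv.apply_eq_smul, Module.End.mul_apply, hr]

/-! ### Strassmann-type bound: zeros of p-adic binomial series. -/

section Strassmann

open Polynomial

/-! Expanding indicators in characters, the family is mixing as soon as, for every nontrivial tuple
of characters, `∏ χ i ∘ T i ^ n` is nontrivial for all large `n` (`isMixing_of_eventually_ne_one`).
Connectedness makes the dual torsion free, so it embeds in `RatDual X`, where triviality of the
product reads `∑ T̂ i ^ n (v i) = 0`. If this happens for infinitely many `n`, Skolem–Mahler–Lech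
(`Module.End.exists_progression_of_infinite`) makes it happen along a whole progression `r + N k`.
The root-of-unity condition says exactly that all differences `T̂ j ^ l - T̂ i ^ l`, `l ≥ 1`, are
injective (`forall_not_hasEigenvalueInvMul_iff`); with `l = N`, a Vandermonde elimination for
commuting operators kills every `v i`. Conversely, a kernel vector of such a difference, cleared of
denominators, is a nontrivial character with `χ ∘ T i ^ (l k) = χ ∘ T j ^ (l k)` for all `k`, which
contradicts mixing of the pair (`IsMixing.eq_one_of_frequently`). Passing from the family to pairs
only requires taking the other sets to be `X`.

Skolem–Mahler–Lech is proved p-adically: a suitable power of each matrix is congruent to `1` mod `p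
^ 2`, so along a progression the sum is a rapidly convergent binomial series, and infinitely many
zeros force it to vanish.

Two facts on compact abelian groups are also needed. Characters separate points
(`exists_pontryaginDual_ne_one`), by Gelfand theory on the bicommutant of the regular
representation. Covering dimension `d` bounds the rank of the dual by `d`
(`CoveringDimLE.not_independent`): `d + 1` independent characters give `1`-cocycles whose cup
product has nonzero integral on a small cube, whereas a cover of order `d + 1` allows these cocycles
to be modified by coboundaries so that the product vanishes. -/

theorem Polynomial.pow_dvd_coeff_of_X_sub_C_mul {R : Type*} [CommRing R] {q t : R} {e : ℕ}
    {Q : R[X]} (h : ∀ j, q ^ (e + j) ∣ ((X - C t) * Q).coeff j) (j : ℕ) :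
    q ^ (e + 1 + j) ∣ Q.coeff j := by
  suffices H : ∀ k j, Q.natDegree < j + k → q ^ (e + 1 + j) ∣ Q.coeff j from
    H (Q.natDegree + 1) j (by omega)
  intro k
  induction k with
  | zero =>
    intro j hj
    rw [coeff_eq_zero_of_natDegree_lt (by simpa using hj)]
    exact dvd_zero _
  | succ k ih =>
    intro j hj
    have h1 := h (j + 1)
    rw [sub_mul, coeff_sub, coeff_X_mul, coeff_C_mul] at h1
    have h2 := (pow_dvd_pow q (by omega : e + 1 + j ≤ e + 1 + (j + 1))).trans
      (ih (j + 1) (by omega))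
    have h3 := dvd_add ((pow_dvd_pow q (by omega : e + 1 + j ≤ e + (j + 1))).trans h1)
      (h2.mul_left t)
    simpa using h3

/-- Each root divided out improves the divisibility of all coefficients by one factor `q`, so a
polynomial with many roots takes only highly divisible values. -/
theorem Polynomial.pow_dvd_eval_of_roots {R : Type*} [CommRing R] [IsDomain R] {q : R}
    (S : Finset R) {e : ℕ} {P : R[X]} (h : ∀ j, q ^ (e + j) ∣ P.coeff j)
    (hS : ∀ a ∈ S, P.eval a = 0) (t : R) : q ^ (e + S.card) ∣ P.eval t := by
  classical
  induction S using Finset.induction_on generalizing P e with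
  | empty =>
    rw [eval_eq_sum_range]
    refine Finset.dvd_sum fun i _ => Dvd.dvd.mul_right ?_ _
    exact (pow_dvd_pow q (by simp)).trans (h i)
  | insert a S ha ih =>
    obtain ⟨Q, rfl⟩ := dvd_iff_isRoot.mpr (hS a (Finset.mem_insert_self a S))
    have := ih (e := e + 1) (fun j => pow_dvd_coeff_of_X_sub_C_mul h j) (fun b hb => by
      have h1 := hS b (Finset.mem_insert_of_mem hb)
      rw [eval_mul, mul_eq_zero] at h1
      refine h1.resolve_left ?_
      rw [eval_sub, eval_X, eval_C, sub_eq_zero]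
      rintro rfl
      exact ha hb)
    rw [Finset.card_insert_of_notMem ha, eval_mul, ← add_assoc, add_right_comm]
    exact this.mul_left _

variable {p : ℕ} [Fact p.Prime]

theorem PadicInt.factorial_dvd_pow (m : ℕ) : ((m.factorial : ℕ) : ℤ_[p]) ∣ (p : ℤ_[p]) ^ m := by
  have hp : p.Prime := Fact.out
  have h0 : ((m.factorial : ℕ) : ℤ_[p]) ≠ 0 := by exact_mod_cast m.factorial_ne_zero
  have h1 : padicValNat p m.factorial ≤ m := by
    have := sub_one_mul_padicValNat_factorial (p := p) m
    have h2 : 1 ≤ p - 1 := by have := hp.two_le; omega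
    nlinarith [Nat.sub_le m (Nat.digits p m).sum]
  rw [PadicInt.unitCoeff_spec h0]
  refine (Units.isUnit _).mul_left_dvd.mpr (pow_dvd_pow _ ?_)
  rw [← Nat.cast_le (α := ℤ), ← PadicInt.valuation_coe]
  simpa using h1

theorem PadicInt.eq_zero_of_forall_pow_dvd {x : ℤ_[p]} (h : ∀ k : ℕ, (p : ℤ_[p]) ^ k ∣ x) :
    x = 0 := by
  by_contra hx
  have h1 := (PadicInt.mem_span_pow_iff_le_valuation x hx (x.valuation + 1)).mp
    (Ideal.mem_span_singleton.mpr (h _))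
  omega

/-- A binomial series over `ℤ_[p]` whose `m`-th coefficient is divisible by `p ^ (2 * m)` vanishes
identically as soon as it has infinitely many zeros in `ℕ`. -/
theorem PadicInt.binomial_series_eq_zero (b : ℕ → ℤ_[p]) {f : ℕ → ℤ_[p]}
    (hf : ∀ k, f k = ∑ m ∈ Finset.range (k + 1), (k.choose m : ℤ_[p]) * (p : ℤ_[p]) ^ (2 * m) * b m)
    (hinf : {k | f k = 0}.Infinite) (k : ℕ) : f k = 0 := by
  classical
  choose u hu using fun m => PadicInt.factorial_dvd_pow (p := p) m
  -- Of the factor `p ^ (2 * m)`, one `p ^ m` absorbs the denominator `m!` of the binomial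
  -- coefficient; the other stays in the coefficients. Terms with `m > k` vanish at `k`, so
  -- truncation at `n` is exact for `k ≤ n`.
  let P : ℕ → ℤ_[p][X] := fun n =>
    ∑ m ∈ Finset.range (n + 1), C ((p : ℤ_[p]) ^ m * (u m * b m)) * descPochhammer ℤ_[p] m
  have hP : ∀ n k, k ≤ n → (P n).eval (k : ℤ_[p]) = f k := by
    intro n k hk
    rw [hf, eval_finsetSum]
    symm
    rw [← Finset.sum_subset (Finset.range_mono (Nat.succ_le_succ hk))]
    · refine Finset.sum_congr rfl fun m _ => ?_
      rw [eval_mul, eval_C, descPochhammer_eval_eq_descFactorial,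
        Nat.descFactorial_eq_factorial_mul_choose, two_mul, pow_add]
      nth_rewrite 1 [hu m]
      push_cast
      ring
    · intro m _ hm
      rw [eval_mul, descPochhammer_eval_eq_descFactorial, Nat.descFactorial_of_lt]
      · simp
      · simpa using hm
  have hc : ∀ n j, (p : ℤ_[p]) ^ (0 + j) ∣ (P n).coeff j := by
    intro n j
    rw [finsetSum_coeff, zero_add]
    refine Finset.dvd_sum fun m _ => ?_
    rw [coeff_C_mul]
    by_cases hj : j ≤ m
    · exact ((pow_dvd_pow _ hj).mul_right _).mul_right _
    · rw [coeff_eq_zero_of_natDegree_lt (by rw [descPochhammer_natDegree]; omega), mul_zero]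
      exact dvd_zero _
  refine PadicInt.eq_zero_of_forall_pow_dvd fun K => ?_
  obtain ⟨S, hS, hcard⟩ := hinf.exists_subset_card_eq K
  have hinj : Function.Injective ((↑) : ℕ → ℤ_[p]) := Nat.cast_injective
  -- The truncation is taken beyond the `K` chosen zeros and beyond `k`, so one polynomial sees them
  -- all; hence `p ^ K` divides `f k` for every `K`.
  have h1 := pow_dvd_eval_of_roots (S.image ((↑) : ℕ → ℤ_[p])) (hc (S.sup id + k))
    (by
      intro a ha
      obtain ⟨s, hs, rfl⟩ := Finset.mem_image.mp ha
      rw [hP _ s (le_add_right (Finset.le_sup (f := id) hs))]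
      exact hS hs) (k : ℤ_[p])
  rw [Finset.card_image_of_injective _ hinj, hcard, zero_add, hP _ _ (by omega)] at h1
  exact h1

end Strassmann

/-! ### Skolem–Mahler–Lech for orbits of matrices. -/

section SkolemMahlerLech

open Matrix

variable {p : ℕ} [Fact p.Prime] {ι n : Type*} [Fintype n] [DecidableEq n]

/-- Expanding `(1 + p ^ 2 B) ^ k` by the binomial theorem turns each coordinate into a series to
which `PadicInt.binomial_series_eq_zero` applies. -/
theorem Matrix.sum_pow_mulVec_eq_zero_of_congruent_one [Fintype ι] (B : ι → Matrix n n ℤ_[p]) (w : ι → n → ℤ_[p])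
    (hinf : {k : ℕ | ∑ i, (1 + (p : ℤ_[p]) ^ 2 • B i) ^ k *ᵥ w i = 0}.Infinite) (k : ℕ) :
    ∑ i, (1 + (p : ℤ_[p]) ^ 2 • B i) ^ k *ᵥ w i = 0 := by
  funext a
  refine PadicInt.binomial_series_eq_zero (fun m => ∑ i, (B i ^ m *ᵥ w i) a)
    (f := fun k => (∑ i, (1 + (p : ℤ_[p]) ^ 2 • B i) ^ k *ᵥ w i) a) (fun k => ?_)
    (hinf.mono fun k hk => by simp only [mem_ofPred_eq] at hk ⊢; rw [hk]; rfl) k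
  simp only [Finset.sum_apply, Finset.mul_sum]
  rw [Finset.sum_comm]
  refine Finset.sum_congr rfl fun i _ => ?_
  rw [add_comm, (Commute.one_right _).add_pow, Matrix.sum_mulVec, Finset.sum_apply]
  refine Finset.sum_congr rfl fun m _ => ?_
  rw [one_pow, mul_one, smul_pow, ← Nat.cast_comm, ← nsmul_eq_mul, Matrix.smul_mulVec,
    Matrix.smul_mulVec, ← pow_mul]
  simp [mul_assoc]

theorem Set.Infinite.exists_add_mul {S : Set ℕ} (hS : S.Infinite) {N : ℕ} (hN : 0 < N) :
    ∃ r, {k | r + N * k ∈ S}.Infinite := by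
  by_contra! h
  refine hS (((Set.finite_lt_nat N).biUnion fun r _ => (h r).image fun k => r + N * k).subset ?_)
  intro m hm
  simp only [mem_iUnion]
  exact ⟨m % N, Nat.mod_lt m hN, m / N, by simpa [Nat.mod_add_div] using hm, Nat.mod_add_div m N⟩

/-- Invertible matrices reduce into the finite group of invertible matrices over `ZMod (p ^ 2)`; by
Lagrange its order is an exponent that works for all `i` at once. -/
theorem Matrix.exists_pow_eq_one_add (A : ι → (Matrix n n ℤ_[p])ˣ) :
    ∃ N, 0 < N ∧ ∃ B : ι → Matrix n n ℤ_[p],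
      ∀ i, (A i : Matrix n n ℤ_[p]) ^ N = 1 + (p : ℤ_[p]) ^ 2 • B i := by
  have hp : p.Prime := Fact.out
  have : NeZero (p ^ 2) := ⟨pow_ne_zero 2 hp.ne_zero⟩
  let φ : Matrix n n ℤ_[p] →+* Matrix n n (ZMod (p ^ 2)) := (PadicInt.toZModPow 2).mapMatrix
  refine ⟨Nat.card (Matrix n n (ZMod (p ^ 2)))ˣ, Nat.card_pos, ?_⟩
  have key : ∀ i a b, ∃ c, ((A i : Matrix n n ℤ_[p]) ^ Nat.card (Matrix n n (ZMod (p ^ 2)))ˣ - 1) a b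
      = (p : ℤ_[p]) ^ 2 * c := by
    intro i a b
    have h1 : φ ((A i : Matrix n n ℤ_[p]) ^ Nat.card (Matrix n n (ZMod (p ^ 2)))ˣ - 1) = 0 := by
      have := congrArg Units.val (pow_card_eq_one' (x := Units.map φ.toMonoidHom (A i)))
      rw [map_sub, map_pow, map_one, sub_eq_zero]
      rwa [Units.val_pow_eq_pow_val] at this
    have h2 := congrFun (congrFun h1 a) b
    have h3 : ((A i : Matrix n n ℤ_[p]) ^ Nat.card (Matrix n n (ZMod (p ^ 2)))ˣ - 1) a b ∈
        RingHom.ker (PadicInt.toZModPow (p := p) 2) := h2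
    rw [PadicInt.ker_toZModPow, Ideal.mem_span_singleton] at h3
    exact h3
  choose c hc using key
  refine ⟨fun i => Matrix.of (c i), fun i => ?_⟩
  rw [← sub_eq_iff_eq_add']
  ext a b
  rw [hc]
  rfl

theorem Matrix.exists_progression_of_infinite_padic [Fintype ι] (A : ι → (Matrix n n ℤ_[p])ˣ) (w : ι → n → ℤ_[p])
    (hinf : {k : ℕ | ∑ i, (A i : Matrix n n ℤ_[p]) ^ k *ᵥ w i = 0}.Infinite) :
    ∃ N r, 0 < N ∧ ∀ k, ∑ i, (A i : Matrix n n ℤ_[p]) ^ (r + N * k) *ᵥ w i = 0 := by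
  obtain ⟨N, hN, B, hB⟩ := Matrix.exists_pow_eq_one_add A
  obtain ⟨r, hr⟩ := hinf.exists_add_mul hN
  have h1 : ∀ k, ∑ i, (A i : Matrix n n ℤ_[p]) ^ (r + N * k) *ᵥ w i =
      ∑ i, (1 + (p : ℤ_[p]) ^ 2 • B i) ^ k *ᵥ ((A i : Matrix n n ℤ_[p]) ^ r *ᵥ w i) := by
    intro k
    refine Finset.sum_congr rfl fun i _ => ?_
    rw [add_comm, pow_add, pow_mul, hB, Matrix.mulVec_mulVec]
  refine ⟨N, r, hN, fun k => ?_⟩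
  rw [h1]
  refine Matrix.sum_pow_mulVec_eq_zero_of_congruent_one B _ (hr.mono fun k hk => ?_) k
  simpa only [mem_ofPred_eq, h1] using hk

theorem Rat.exists_prime_not_dvd_den (F : Finset ℚ) : ∃ p : ℕ, p.Prime ∧ ∀ q ∈ F, ¬ p ∣ q.den := by
  obtain ⟨p, hp, hpp⟩ := Nat.exists_infinite_primes (F.sup Rat.den + 1)
  refine ⟨p, hpp, fun q hq hd => ?_⟩
  have h1 := Nat.le_of_dvd q.den_pos hd
  have h2 : q.den ≤ F.sup Rat.den := Finset.le_sup hq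
  omega

theorem Matrix.exists_progression_of_infinite_rat [Fintype ι] (M : ι → (Matrix n n ℚ)ˣ) (c : ι → n → ℚ)
    (hinf : {k : ℕ | ∑ i, (M i : Matrix n n ℚ) ^ k *ᵥ c i = 0}.Infinite) :
    ∃ N r, 0 < N ∧ ∀ k, ∑ i, (M i : Matrix n n ℚ) ^ (r + N * k) *ᵥ c i = 0 := by
  classical
  -- The inverses are included so that the matrices stay invertible over `ℤ_[p]`.
  obtain ⟨p, hp, hF⟩ := Rat.exists_prime_not_dvd_den
    (Finset.univ.image (fun x : ι × n × n => (M x.1 : Matrix n n ℚ) x.2.1 x.2.2) ∪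
      Finset.univ.image (fun x : ι × n × n => (↑(M x.1)⁻¹ : Matrix n n ℚ) x.2.1 x.2.2) ∪
      Finset.univ.image (fun x : ι × n => c x.1 x.2))
  have : Fact p.Prime := ⟨hp⟩
  let ψ : ℤ_[p] →+* ℚ_[p] := PadicInt.Coe.ringHom
  let ρ : ℚ →+* ℚ_[p] := Rat.castHom _
  -- The value `0` is junk: every entry to which `φ` is applied is p-integral by the choice of `p`.
  let φ : ℚ → ℤ_[p] := fun q => if h : ‖(q : ℚ_[p])‖ ≤ 1 then ⟨q, h⟩ else 0
  have hφ : ∀ q : ℚ, ¬ p ∣ q.den → ψ (φ q) = ρ q := by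
    intro q hq
    have h1 : φ q = ⟨q, Padic.norm_rat_le_one hq⟩ := dif_pos (Padic.norm_rat_le_one hq)
    rw [h1]
    rfl
  have hψ : Function.Injective ψ := Subtype.val_injective
  have hM : ∀ i, ((M i : Matrix n n ℚ).map φ).map ψ = (M i : Matrix n n ℚ).map ρ := by
    intro i
    ext a b
    exact hφ _ (hF _ (Finset.mem_union_left _ (Finset.mem_union_left _
      (Finset.mem_image_of_mem (fun x : ι × n × n => (M x.1 : Matrix n n ℚ) x.2.1 x.2.2)
        (Finset.mem_univ (i, a, b))))))
  have hM' : ∀ i, ((↑(M i)⁻¹ : Matrix n n ℚ).map φ).map ψ = (↑(M i)⁻¹ : Matrix n n ℚ).map ρ := by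
    intro i
    ext a b
    exact hφ _ (hF _ (Finset.mem_union_left _ (Finset.mem_union_right _
      (Finset.mem_image_of_mem (fun x : ι × n × n => (↑(M x.1)⁻¹ : Matrix n n ℚ) x.2.1 x.2.2)
        (Finset.mem_univ (i, a, b))))))
  have hc : ∀ i, ψ ∘ (φ ∘ c i) = ρ ∘ c i := by
    intro i
    funext a
    exact hφ _ (hF _ (Finset.mem_union_right _
      (Finset.mem_image_of_mem (fun x : ι × n => c x.1 x.2) (Finset.mem_univ (i, a)))))
  let A : ι → (Matrix n n ℤ_[p])ˣ := fun i =>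
    { val := (M i : Matrix n n ℚ).map φ
      inv := (↑(M i)⁻¹ : Matrix n n ℚ).map φ
      val_inv := by
        apply Matrix.map_injective hψ
        dsimp only
        rw [Matrix.map_mul, hM, hM', ← Matrix.map_mul, Units.mul_inv]
        simp
      inv_val := by
        apply Matrix.map_injective hψ
        dsimp only
        rw [Matrix.map_mul, hM, hM', ← Matrix.map_mul, Units.inv_mul]
        simp }
  have key : ∀ k : ℕ, ∑ i, (A i : Matrix n n ℤ_[p]) ^ k *ᵥ (φ ∘ c i) = 0 ↔
      ∑ i, (M i : Matrix n n ℚ) ^ k *ᵥ c i = 0 := by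
    intro k
    have h1 : ∀ a, ψ ((∑ i, (A i : Matrix n n ℤ_[p]) ^ k *ᵥ (φ ∘ c i)) a) =
        ρ ((∑ i, (M i : Matrix n n ℚ) ^ k *ᵥ c i) a) := by
      intro a
      simp only [Finset.sum_apply, map_sum]
      refine Finset.sum_congr rfl fun i _ => ?_
      have h2 : ψ.mapMatrix ((A i : Matrix n n ℤ_[p]) ^ k) =
          ρ.mapMatrix ((M i : Matrix n n ℚ) ^ k) := by
        rw [map_pow, map_pow]
        exact congrArg (· ^ k) (hM i)
      rw [RingHom.map_mulVec, RingHom.map_mulVec, hc]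
      exact congrArg (fun m => (m *ᵥ (ρ ∘ c i)) a) h2
    constructor
    · intro h
      funext a
      apply ρ.injective
      rw [← h1, h]
      simp
    · intro h
      funext a
      apply hψ
      rw [h1, h]
      simp
  obtain ⟨N, r, hN, h⟩ := Matrix.exists_progression_of_infinite_padic A (fun i => φ ∘ c i)
    (by simpa only [key] using hinf)
  exact ⟨N, r, hN, fun k => (key _).mp (h k)⟩

/-- **Skolem–Mahler–Lech** for sums of orbits of invertible endomorphisms of a finite-dimensional
rational vector space: a set of zeros that is infinite contains an arithmetic progression. -/
theorem Module.End.exists_progression_of_infinite [Fintype ι] {V : Type*} [AddCommGroup V] [Module ℚ V]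
    [FiniteDimensional ℚ V] (T : ι → (Module.End ℚ V)ˣ) (v : ι → V)
    (hinf : {k : ℕ | ∑ i, ((T i : Module.End ℚ V) ^ k) (v i) = 0}.Infinite) :
    ∃ N r, 0 < N ∧ ∀ k, ∑ i, ((T i : Module.End ℚ V) ^ (r + N * k)) (v i) = 0 := by
  let b := Module.finBasis ℚ V
  let e := LinearMap.toMatrixAlgEquiv b
  let M : ι → (Matrix (Fin (Module.finrank ℚ V)) (Fin (Module.finrank ℚ V)) ℚ)ˣ := fun i =>
    Units.map (e : Module.End ℚ V →* Matrix _ _ ℚ) (T i)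
  have key : ∀ k : ℕ, ∑ i, (M i).val ^ k *ᵥ
      (b.repr (v i)) = 0 ↔ ∑ i, ((T i : Module.End ℚ V) ^ k) (v i) = 0 := by
    intro k
    rw [← LinearEquiv.map_eq_zero_iff b.equivFun, map_sum]
    refine Eq.congr_left (Finset.sum_congr rfl fun i _ => ?_)
    change e (T i) ^ k *ᵥ _ = _
    rw [← map_pow]
    exact LinearMap.toMatrix_mulVec_repr b b _ _
  obtain ⟨N, r, hN, h⟩ := Matrix.exists_progression_of_infinite_rat M (fun i => b.repr (v i))
    (by simpa only [key] using hinf)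
  exact ⟨N, r, hN, fun k => (key _).mp (h k)⟩

/-- Independence of the orbits of commuting endomorphisms with injective pairwise differences. -/
theorem Module.End.eq_zero_of_sum_pow_eq_zero {R V : Type*} [Ring R] [AddCommGroup V] [Module R V]
    (A : ι → Module.End R V) (hA : ∀ i j, Commute (A i) (A j)) (S : Finset ι)
    (hinj : ∀ i ∈ S, ∀ j ∈ S, i ≠ j → Function.Injective (A i - A j)) (w : ι → V)
    (h : ∀ k : ℕ, ∑ i ∈ S, (A i ^ k) (w i) = 0) : ∀ i ∈ S, w i = 0 := by
  classical
  induction S using Finset.induction_on generalizing w with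
  | empty => simp
  | insert a S ha ih =>
    -- Vandermonde elimination: relation `k + 1` minus `A a` applied to relation `k` removes the
    -- index `a` and replaces `w i` by `(A i - A a) (w i)`.
    have h1 : ∀ i ∈ S, (A i - A a) (w i) = 0 := by
      refine ih (fun i hi j hj => hinj i (Finset.mem_insert_of_mem hi) j
        (Finset.mem_insert_of_mem hj)) (fun i => (A i - A a) (w i)) fun k => ?_
      have h2 := h (k + 1)
      have h3 := congrArg (A a) (h k)
      rw [Finset.sum_insert ha] at h2 h3
      rw [map_add, map_sum, map_zero, ← Module.End.mul_apply, ← pow_succ'] at h3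
      rw [← sub_eq_zero_of_eq (h2.trans h3.symm), add_sub_add_left_eq_sub, ← Finset.sum_sub_distrib]
      refine Finset.sum_congr rfl fun i _ => ?_
      rw [← Module.End.mul_apply, ← Module.End.mul_apply, mul_sub, ← pow_succ,
        ((hA a i).pow_right k).eq, LinearMap.sub_apply]
    have h2 : ∀ i ∈ S, w i = 0 := fun i hi =>
      hinj i (Finset.mem_insert_of_mem hi) a (Finset.mem_insert_self a S)
        (by rintro rfl; exact ha hi) ((h1 i hi).trans (map_zero _).symm)
    intro i hi
    rcases Finset.mem_insert.mp hi with rfl | hi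
    · have h3 := h 0
      rw [Finset.sum_insert ha, Finset.sum_eq_zero fun j hj => by simp [h2 j hj]] at h3
      simpa using h3
    · exact h2 i hi

end SkolemMahlerLech

/-! ### Roots of unity as eigenvalues and injectivity of differences of powers. -/

section Eigenvalues

variable {V : Type*} [AddCommGroup V] [Module ℚ V]

theorem baseChange_complex_injective {A : Module.End ℚ V} (hA : Function.Injective A) :
    Function.Injective (A.baseChange ℂ) :=
  Module.Flat.lTensor_preserves_injective_linearMap (M := ℂ) A hA

/-- No root of unity is an eigenvalue of `A⁻¹ B` if and only if all differences `B ^ l - A ^ l`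
are injective. -/
theorem forall_not_hasEigenvalueInvMul_iff [FiniteDimensional ℚ V] {A B : Module.End ℚ V}
    (hA : IsUnit A) (hAB : Commute A B) :
    (∀ ζ : ℂ, (∃ l : ℕ, 1 ≤ l ∧ ζ ^ l = 1) → ¬ HasEigenvalueInvMul A B ζ) ↔
      ∀ l : ℕ, 1 ≤ l → Function.Injective (B ^ l - A ^ l) := by
  constructor
  · intro h l hl
    obtain ⟨A, rfl⟩ := hA
    rw [injective_iff_map_eq_zero]
    intro w hw
    by_contra hw0
    set M : Module.End ℂ (ℂ ⊗[ℚ] V) :=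
      LinearMap.baseChange ℂ ((↑A⁻¹ : Module.End ℚ V) * B) with hM
    have hc : Commute (↑A⁻¹ : Module.End ℚ V) B := hAB.units_inv_left
    have h1 : (((↑A⁻¹ : Module.End ℚ V) * B) ^ l) w = w := by
      rw [hc.mul_pow, Module.End.mul_apply]
      rw [LinearMap.sub_apply, sub_eq_zero] at hw
      rw [hw, ← Module.End.mul_apply, ← Units.val_pow_eq_pow_val, ← Units.val_pow_eq_pow_val,
        ← Units.val_mul, inv_pow, inv_mul_cancel]
      rfl
    have h2 : (M ^ l).HasEigenvalue 1 := by
      refine Module.End.hasEigenvalue_of_hasEigenvector (x := (1 : ℂ) ⊗ₜ[ℚ] w)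
        ⟨Module.End.mem_eigenspace_iff.mpr ?_, ?_⟩
      · rw [hM, ← LinearMap.baseChange_pow, LinearMap.baseChange_tmul, h1, one_smul]
      · intro h0
        apply hw0
        have hinj : Function.Injective ((TensorProduct.mk ℚ ℂ V) 1) :=
          Module.FaithfullyFlat.tensorProduct_mk_injective V
        exact hinj (h0.trans (map_zero _).symm)
    -- Spectral mapping over `ℂ`: the eigenvalue `1` of `M ^ l` is `ζ ^ l` for an eigenvalue `ζ` of
    -- `M`.
    rw [Module.End.hasEigenvalue_iff_mem_spectrum, spectrum.map_pow_of_pos M hl] at h2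
    obtain ⟨ζ, hζ, hζl⟩ := h2
    refine h ζ ⟨l, hl, hζl⟩ ((hasEigenvalueInvMul_iff A B ζ).mpr ?_)
    rwa [Module.End.hasEigenvalue_iff_mem_spectrum]
  · rintro h ζ ⟨l, hl, hζ⟩ ⟨v, hv, hv'⟩
    have hc : Commute (A.baseChange ℂ) (B.baseChange ℂ) := by
      rw [commute_iff_eq, ← LinearMap.baseChange_mul, hAB.eq, LinearMap.baseChange_mul]
    have h1 : ∀ k : ℕ, ((B.baseChange ℂ) ^ k) v = ζ ^ k • ((A.baseChange ℂ) ^ k) v := by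
      intro k
      induction k with
      | zero => simp
      | succ k ih =>
        rw [pow_succ', Module.End.mul_apply, ih, map_smul, ← Module.End.mul_apply,
          ← (hc.pow_left k).eq, Module.End.mul_apply, hv', map_smul, smul_smul, pow_succ,
          pow_succ (A.baseChange ℂ), Module.End.mul_apply]
    apply hv
    apply baseChange_complex_injective (h l hl)
    rw [LinearMap.baseChange_sub, LinearMap.baseChange_pow, LinearMap.baseChange_pow,
      LinearMap.sub_apply, h1, hζ, one_smul, sub_self, map_zero]

end Eigenvalues

/-! ### Characters of commutative C⋆-algebras. -/

section GelfandSeparation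

/-- A nonzero element of a commutative closed star subalgebra of a C⋆-algebra is not annihilated by
all characters. -/
theorem StarSubalgebra.exists_character_ne_zero {B : Type*} [CStarAlgebra B] (S : StarSubalgebra ℂ B)
    (hS : IsClosed (S : Set B)) (hcomm : ∀ a ∈ S, ∀ b ∈ S, a * b = b * a) {a : S} (ha : a ≠ 0) :
    ∃ φ : S →ₐ[ℂ] ℂ, Continuous φ ∧ φ a ≠ 0 := by
  have := hS
  let _ : CommCStarAlgebra S :=
    { (inferInstance : CStarAlgebra S) with
      mul_comm := fun a b => Subtype.ext (hcomm a a.2 b b.2) }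
  have h1 : WeakDual.gelfandTransform ℂ S a ≠ 0 := fun h =>
    ha ((gelfandTransform_isometry S).injective (h.trans (map_zero _).symm))
  obtain ⟨φ, hφ⟩ := DFunLike.ne_iff.mp h1
  exact ⟨WeakDual.CharacterSpace.toAlgHom φ, map_continuous φ, hφ⟩

end GelfandSeparation

section Translate

variable {X : Type*} [TopologicalSpace X] [CommGroup X] [IsTopologicalGroup X]

/-- The translate `y ↦ f (x⁻¹ y)` of a continuous function. -/
noncomputable def ContinuousMap.translate (f : C(X, ℂ)) (x : X) : C(X, ℂ) :=
  ⟨fun y => f (x⁻¹ * y), by fun_prop⟩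

theorem ContinuousMap.continuous_translate (f : C(X, ℂ)) : Continuous f.translate :=
  (ContinuousMap.mk (fun p : X × X => f (p.1⁻¹ * p.2)) (by fun_prop)).curry.continuous

end Translate

/-! ### From unitary representations to continuous characters. -/

section UnitaryRepresentation

variable {X : Type*} [TopologicalSpace X] [CommGroup X] [IsTopologicalGroup X] [CompactSpace X]
  [MeasurableSpace X] [BorelSpace X]

instance : (normalizedHaar X).IsHaarMeasure :=
  inferInstanceAs (Measure.haarMeasure (⊤ : PositiveCompacts X)).IsHaarMeasure

instance : IsProbabilityMeasure (normalizedHaar X) :=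
  ⟨Measure.haarMeasure_self (K₀ := (⊤ : PositiveCompacts X))⟩

instance : (normalizedHaar X).Regular :=
  inferInstanceAs (Measure.haarMeasure (⊤ : PositiveCompacts X)).Regular

theorem Continuous.integrable_normalizedHaar {E : Type*} [NormedAddCommGroup E] {f : X → E}
    (hf : Continuous f) : Integrable f (normalizedHaar X) :=
  hf.integrable_of_hasCompactSupport (HasCompactSupport.of_compactSpace f)

variable {H : Type*} [NormedAddCommGroup H] [InnerProductSpace ℂ H]

theorem integrable_smul_rep {U : X →* (H →L[ℂ] H)} (hU : ∀ h, Continuous fun x => U x h)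
    (f : C(X, ℂ)) (h : H) : Integrable (fun y => f y • U y h) (normalizedHaar X) :=
  Continuous.integrable_normalizedHaar (f.continuous.smul (hU h))

/-- The operator `∫ f y • U y` attached to a representation `U` of a compact group. -/
noncomputable def integratedRep (U : X →* (H →L[ℂ] H)) (hU : ∀ h, Continuous fun x => U x h)
    (hn : ∀ x h, ‖U x h‖ ≤ ‖h‖) (f : C(X, ℂ)) : H →L[ℂ] H :=
  LinearMap.mkContinuous
    { toFun := fun h => ∫ y, f y • U y h ∂(normalizedHaar X)
      map_add' := fun g h => by
        simp only [map_add, smul_add]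
        exact integral_add (integrable_smul_rep hU f g)
          (integrable_smul_rep hU f h)
      map_smul' := fun c h => by
        simp only [map_smul, RingHom.id_apply]
        rw [← integral_smul]
        simp only [smul_comm c] }
    ‖f‖ fun h => by
      refine (norm_integral_le_of_norm_le_const (C := ‖f‖ * ‖h‖)
        (Eventually.of_forall fun y => ?_)).trans (by simp)
      rw [norm_smul]
      exact mul_le_mul (f.norm_coe_le_norm y) (hn y h) (norm_nonneg _) (norm_nonneg _)

variable {U : X →* (H →L[ℂ] H)} {hU : ∀ h, Continuous fun x => U x h}
  {hn : ∀ x h, ‖U x h‖ ≤ ‖h‖}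

theorem integratedRep_apply (f : C(X, ℂ)) (h : H) :
    integratedRep U hU hn f h = ∫ y, f y • U y h ∂(normalizedHaar X) := rfl

theorem norm_integratedRep_sub_le (f g : C(X, ℂ)) :
    ‖integratedRep U hU hn f - integratedRep U hU hn g‖ ≤ ‖f - g‖ := by
  refine ContinuousLinearMap.opNorm_le_bound _ (norm_nonneg _) fun h => ?_
  rw [_root_.sub_apply, integratedRep_apply, integratedRep_apply, ← integral_sub
    (integrable_smul_rep hU f h)
    (integrable_smul_rep hU g h)]
  refine (norm_integral_le_of_norm_le_const (C := ‖f - g‖ * ‖h‖)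
    (Eventually.of_forall fun y => ?_)).trans (by simp)
  rw [← sub_smul, norm_smul]
  exact mul_le_mul ((f - g).norm_coe_le_norm y) (hn y h) (norm_nonneg _) (norm_nonneg _)

theorem continuous_integratedRep : Continuous (integratedRep U hU hn) :=
  (LipschitzWith.of_dist_le_mul (K := 1) fun f g => by
    simpa [dist_eq_norm] using norm_integratedRep_sub_le f g).continuous

theorem commute_integratedRep [CompleteSpace H] {A : H →L[ℂ] H} (hA : ∀ x, A * U x = U x * A) (f : C(X, ℂ)) :
    A * integratedRep U hU hn f = integratedRep U hU hn f * A := by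
  ext h
  rw [mul_apply_eq_comp, mul_apply_eq_comp, integratedRep_apply,
    integratedRep_apply,
    ← A.integral_comp_comm (integrable_smul_rep hU f h)]
  refine integral_congr_ae (Eventually.of_forall fun y => ?_)
  simp only [map_smul]
  rw [← mul_apply_eq_comp, hA, mul_apply_eq_comp]

theorem mul_integratedRep [CompleteSpace H] (f : C(X, ℂ)) (x : X) :
    U x * integratedRep U hU hn f = integratedRep U hU hn (f.translate x) := by
  ext h
  rw [mul_apply_eq_comp, integratedRep_apply, integratedRep_apply,
    ← ContinuousLinearMap.integral_comp_comm (U x) (integrable_smul_rep hU f h),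
    ← integral_mul_left_eq_self (fun y => f.translate x y • U y h) x]
  refine integral_congr_ae (Eventually.of_forall fun y => ?_)
  simp [ContinuousMap.translate]

/-- Approximate identity: for a bump `f` near `1` of mass `c`, the integrated operator sends `h` to
within `c * δ / 3` of `c • h`. Were its image fixed by `U x`, then `c • h` would move by at most
twice that, but it moves by `c * δ`. -/
theorem exists_integratedRep_ne [T2Space X] [CompleteSpace H] {x : X} (hx : U x ≠ 1) :
    ∃ f, (U x - 1) * integratedRep U hU hn f ≠ 0 := by
  obtain ⟨h, hh⟩ := DFunLike.ne_iff.mp hx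
  have hδ : 0 < ‖U x h - h‖ := norm_pos_iff.mpr (sub_ne_zero.mpr hh)
  set δ := ‖U x h - h‖ with hδ_def
  have hN : IsOpen {y | ‖U y h - h‖ < δ / 3} :=
    isOpen_lt ((hU h).sub continuous_const).norm continuous_const
  obtain ⟨g, hg0, hg1, hg⟩ := exists_continuous_zero_one_of_isClosed hN.isClosed_compl
    (isClosed_singleton (x := (1 : X))) (by
      rw [disjoint_singleton_right, notMem_compl_iff]
      simpa using hδ)
  have hc : 0 < ∫ y, g y ∂(normalizedHaar X) :=
    g.continuous.integral_pos_of_hasCompactSupport_nonneg_nonzero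
      (HasCompactSupport.of_compactSpace _) (fun y => (hg y).1) (x := 1)
      (by rw [hg1 rfl]; exact one_ne_zero)
  set c := ∫ y, g y ∂(normalizedHaar X) with hc_def
  let f : C(X, ℂ) := ⟨fun y => (g y : ℂ), by fun_prop⟩
  refine ⟨f, fun h0 => ?_⟩
  have h1 : ‖integratedRep U hU hn f h - (c : ℂ) • h‖ ≤ c * (δ / 3) := by
    have e1 : (c : ℂ) • h = ∫ y, f y • h ∂(normalizedHaar X) := by
      rw [integral_smul_const, hc_def, ← integral_complex_ofReal]
      rfl
    rw [e1, integratedRep_apply, ← integral_sub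
      (integrable_smul_rep hU f h)
      (Continuous.integrable_normalizedHaar (by fun_prop))]
    rw [hc_def, ← integral_mul_const]
    refine norm_integral_le_of_norm_le (g.continuous.mul continuous_const).integrable_normalizedHaar
      (Eventually.of_forall fun y => ?_)
    rw [← smul_sub, norm_smul]
    by_cases hy : y ∈ {y | ‖U y h - h‖ < δ / 3}
    · have : ‖f y‖ = g y := by simp [f, abs_of_nonneg (hg y).1]
      rw [this]
      exact mul_le_mul_of_nonneg_left (le_of_lt hy) (hg y).1
    · have : g y = 0 := hg0 hy
      simp [f, this]
  have h2 : (U x - 1) ((c : ℂ) • h - integratedRep U hU hn f h) = (c : ℂ) • (U x h - h) := by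
    have := DFunLike.congr_fun h0 h
    rw [mul_apply_eq_comp] at this
    rw [map_sub, this, map_smul]
    simp
  have h3 : c * δ ≤ 2 * (c * (δ / 3)) := by
    calc c * δ = ‖(c : ℂ) • (U x h - h)‖ := by
          rw [norm_smul, Complex.norm_real, Real.norm_of_nonneg hc.le]
      _ = ‖U x ((c : ℂ) • h - integratedRep U hU hn f h) -
            ((c : ℂ) • h - integratedRep U hU hn f h)‖ := by rw [← h2]; rfl
      _ ≤ ‖U x ((c : ℂ) • h - integratedRep U hU hn f h)‖ +
            ‖(c : ℂ) • h - integratedRep U hU hn f h‖ := norm_sub_le _ _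
      _ ≤ 2 * ‖(c : ℂ) • h - integratedRep U hU hn f h‖ := by
          rw [two_mul]; gcongr; exact hn _ _
      _ ≤ 2 * (c * (δ / 3)) := by rw [norm_sub_rev]; gcongr
  nlinarith [mul_pos hc hδ]

/-- A strongly continuous unitary representation of a compact abelian group that is nontrivial at `x`
yields a continuous character that is nontrivial at `x`. -/
theorem exists_pontryaginDual_ne_one_of_rep [T2Space X] [CompleteSpace H] {U : X →* (H →L[ℂ] H)}
    (hU : ∀ h, Continuous fun x => U x h) (hn : ∀ x h, ‖U x h‖ ≤ ‖h‖) {x : X} (hx : U x ≠ 1) :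
    ∃ χ : PontryaginDual X, χ x ≠ 1 := by
  have hstar : ∀ x, star (U x) = U x⁻¹ := by
    intro x
    have h1 : star (U x) * U x = 1 := by
      refine (ContinuousLinearMap.norm_map_iff_adjoint_comp_self (U x)).mp fun h => ?_
      refine le_antisymm (hn x h) ?_
      calc ‖h‖ = ‖U x⁻¹ (U x h)‖ := by
            rw [← mul_apply_eq_comp, ← map_mul, inv_mul_cancel, map_one]; rfl
        _ ≤ ‖U x h‖ := hn _ _
    calc star (U x) = star (U x) * (U x * U x⁻¹) := by
          rw [← map_mul, mul_inv_cancel, map_one, mul_one]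
      _ = U x⁻¹ := by rw [← mul_assoc, h1, one_mul]
  -- As `X` is commutative, `U` takes values in its own commutant `Z`. The bicommutant `A` is
  -- therefore contained in `Z`, hence commutative; it is closed and contains all `U y` and all
  -- integrated operators.
  let Z : StarSubalgebra ℂ (H →L[ℂ] H) := StarSubalgebra.centralizer ℂ (range U)
  let A : StarSubalgebra ℂ (H →L[ℂ] H) := StarSubalgebra.centralizer ℂ (Z : Set (H →L[ℂ] H))
  have hUZ : ∀ y, U y ∈ Z := by
    intro y
    rw [StarSubalgebra.mem_centralizer_iff]
    rintro _ ⟨z, rfl⟩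
    rw [hstar, ← map_mul, ← map_mul, ← map_mul, ← map_mul, mul_comm, mul_comm z⁻¹]
    exact ⟨rfl, rfl⟩
  have hAZ : ∀ a ∈ A, a ∈ Z := by
    intro a ha
    rw [StarSubalgebra.mem_centralizer_iff] at ha ⊢
    rintro _ ⟨z, rfl⟩
    exact ha (U z) (hUZ z)
  have hcomm : ∀ a ∈ A, ∀ b ∈ A, a * b = b * a := fun a ha b hb =>
    ((StarSubalgebra.mem_centralizer_iff ℂ).mp hb a (hAZ a ha)).1
  have hZU : ∀ a ∈ Z, ∀ y, a * U y = U y * a := fun a ha y =>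
    (((StarSubalgebra.mem_centralizer_iff ℂ).mp ha (U y) ⟨y, rfl⟩).1).symm
  have hUA : ∀ y, U y ∈ A := by
    intro y
    rw [StarSubalgebra.mem_centralizer_iff]
    exact fun a ha => ⟨hZU a ha y, hZU _ (star_mem ha) y⟩
  have hCA : ∀ f, integratedRep U hU hn f ∈ A := by
    intro f
    rw [StarSubalgebra.mem_centralizer_iff]
    exact fun a ha => ⟨commute_integratedRep (hZU a ha) f,
      commute_integratedRep (hZU _ (star_mem ha)) f⟩
  have hA : IsClosed (A : Set (H →L[ℂ] H)) := Set.isClosed_centralizer _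
  let u : X →* A := U.codRestrict A hUA
  let C : C(X, ℂ) → A := fun f => ⟨integratedRep U hU hn f, hCA f⟩
  have hCc : Continuous C := continuous_integratedRep.subtype_mk _
  have huC : ∀ y f, u y * C f = C (f.translate y) := fun y f => Subtype.ext (mul_integratedRep (hU := hU) (hn := hn) f y)
  obtain ⟨f, hf⟩ := exists_integratedRep_ne (hU := hU) (hn := hn) hx
  obtain ⟨φ, hφ, hne⟩ := A.exists_character_ne_zero hA hcomm
    (a := (u x - 1) * C f) (fun h => hf (congrArg Subtype.val h))
  rw [map_mul, map_sub, map_one, mul_ne_zero_iff, sub_ne_zero] at hne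
  -- `U` is only strongly continuous, whereas `φ` is norm continuous. Dividing by `φ (C f) ≠ 0`
  -- trades `U y` for translation of `f`, which is continuous in the sup norm.
  have hψc : Continuous fun y => φ (u y) := by
    have h1 : (fun y => φ (u y)) = fun y => φ (C (f.translate y)) / φ (C f) := by
      funext y
      rw [← huC, map_mul, mul_div_cancel_right₀ _ hne.2]
    rw [h1]
    exact (hφ.comp (hCc.comp f.continuous_translate)).div_const _
  have hle : ∀ y, ‖φ (u y)‖ ≤ 1 := by
    have : CompleteSpace A := hA.completeSpace_coe
    have : Nontrivial A := ⟨_, _, fun h : (u x - 1) * C f = 0 => hf (congrArg Subtype.val h)⟩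
    have : NormOneClass A := ⟨by
      have : Nontrivial (H →L[ℂ] H) := ⟨_, _, hx⟩
      exact CStarRing.norm_one (E := H →L[ℂ] H)⟩
    intro y
    refine (AlgHom.norm_apply_le_self φ (u y)).trans ?_
    exact ContinuousLinearMap.opNorm_le_bound _ zero_le_one fun h => by
      simpa [u] using hn y h
  have h1 : ∀ y, ‖φ (u y)‖ = 1 := by
    intro y
    refine le_antisymm (hle y) ?_
    have h2 : ‖φ (u y)‖ * ‖φ (u y⁻¹)‖ = 1 := by
      rw [← norm_mul, ← map_mul, ← map_mul, mul_inv_cancel, map_one, map_one, norm_one]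
    nlinarith [hle y⁻¹, norm_nonneg (φ (u y))]
  let χ : X →ₜ* Circle :=
    { toFun := fun y => ⟨φ (u y), mem_sphere_zero_iff_norm.mpr (h1 y)⟩
      map_one' := by ext; simp
      map_mul' := fun y z => Circle.ext
        (show φ (u (y * z)) = φ (u y) * φ (u z) by rw [map_mul, map_mul])
      continuous_toFun := hψc.subtype_mk _ }
  exact ⟨χ, fun h => hne.1 (congrArg Subtype.val h)⟩

end UnitaryRepresentation

section Characters

variable {X : Type*} [TopologicalSpace X] [CommGroup X]

/-- A character of `X` as a continuous complex-valued function. -/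
noncomputable def PontryaginDual.toC (χ : PontryaginDual X) : C(X, ℂ) :=
  ⟨fun x => (χ x : ℂ), by fun_prop⟩

@[simp]
theorem PontryaginDual.toC_apply (χ : PontryaginDual X) (x : X) : χ.toC x = (χ x : ℂ) := rfl

end Characters

/-! ### Separation, density and orthogonality of characters. -/

section PeterWeyl

variable {X : Type*} [TopologicalSpace X] [CommGroup X] [IsTopologicalGroup X] [CompactSpace X]

/-- The regular representation of a compact abelian group on `L²`. -/
noncomputable def regularRep [MeasurableSpace X] [BorelSpace X] :
    X →* (Lp ℂ 2 (normalizedHaar X) →L[ℂ] Lp ℂ 2 (normalizedHaar X)) where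
  toFun x := LinearMap.mkContinuous
    { toFun := fun h => DomMulAct.mk x • h
      map_add' := smul_add _
      map_smul' := fun c h => smul_comm _ c h } 1 fun h => by
        simp [DomMulAct.norm_smul_Lp]
  map_one' := by ext1 h; simp
  map_mul' x y := by
    ext1 h
    simp [mul_comm x y, mul_smul]

/-- The characters of a compact abelian group separate points. -/
theorem exists_pontryaginDual_ne_one [T2Space X] {x : X} (hx : x ≠ 1) :
    ∃ χ : PontryaginDual X, χ x ≠ 1 := by
  borelize X
  have : Fact ((2 : ENNReal) ≠ ⊤) := ⟨ENNReal.ofNat_ne_top⟩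
  refine exists_pontryaginDual_ne_one_of_rep (U := regularRep) (fun h => ?_) (fun x h => ?_)
    (fun h => ?_)
  · exact (DomMulAct.continuous_mk).smul continuous_const
  · exact (DomMulAct.norm_smul_Lp _ _).le
  · obtain ⟨g, hg0, hg1, -⟩ := exists_continuous_zero_one_of_isClosed
      (isClosed_singleton (x := x)) (isClosed_singleton (x := (1 : X))) (by simpa using hx)
    let G : C(X, ℂ) := ⟨fun y => (g y : ℂ), by fun_prop⟩
    let G' : C(X, ℂ) := ⟨fun y => (g (x * y) : ℂ), by fun_prop⟩
    have h1 : regularRep x (ContinuousMap.toLp 2 (normalizedHaar X) ℂ G) =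
        ContinuousMap.toLp 2 (normalizedHaar X) ℂ G' := rfl
    have h2 : G' = G := by
      apply ContinuousMap.toLp_injective (p := 2) (𝕜 := ℂ) (normalizedHaar X)
      rw [← h1, h]
      rfl
    have h3 := DFunLike.congr_fun h2 1
    have h4 : g x = 0 := hg0 rfl
    have h5 : g 1 = 1 := hg1 rfl
    simp [G, G', h4, h5] at h3

/-- A group of characters that separates points spans a dense subspace of `C(X, ℂ)`. -/
theorem PontryaginDual.span_closure_eq_top (Γ : Subgroup (PontryaginDual X))
    (hΓ : ∀ x y : X, x ≠ y → ∃ χ ∈ Γ, χ x ≠ χ y) :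
    (Submodule.span ℂ (PontryaginDual.toC '' (Γ : Set (PontryaginDual X)))).topologicalClosure
      = ⊤ := by
  let S : StarSubalgebra ℂ C(X, ℂ) :=
    { toSubalgebra := Algebra.adjoin ℂ (PontryaginDual.toC '' (Γ : Set (PontryaginDual X)))
      star_mem' := by
        change Algebra.adjoin ℂ _ ≤ star (Algebra.adjoin ℂ _)
        refine Algebra.adjoin_le ?_
        rintro _ ⟨χ, hχ, rfl⟩
        refine Algebra.subset_adjoin ⟨χ⁻¹, Γ.inv_mem hχ, ?_⟩
        ext x
        exact Circle.coe_inv_eq_conj (χ x) }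
  -- Products of characters in `Γ` stay in `Γ`, so the span is already an algebra and
  -- Stone–Weierstrass applies to it.
  have h1 : Subalgebra.toSubmodule S.toSubalgebra =
      Submodule.span ℂ (PontryaginDual.toC '' (Γ : Set (PontryaginDual X))) := by
    apply Algebra.adjoin_eq_span_of_subset
    refine .trans (fun f => Submonoid.closure_induction (fun _ => id) ⟨1, Γ.one_mem, ?_⟩ ?_)
      Submodule.subset_span
    · ext x
      simp
    · rintro _ _ _ _ ⟨χ, hχ, rfl⟩ ⟨ψ, hψ, rfl⟩
      refine ⟨χ * ψ, Γ.mul_mem hχ hψ, ?_⟩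
      ext x
      exact Circle.coe_mul (χ x) (ψ x)
  have h2 : S.SeparatesPoints := by
    intro x y hxy
    obtain ⟨χ, hχ, hne⟩ := hΓ x y hxy
    refine ⟨_, ⟨χ.toC, Algebra.subset_adjoin ⟨χ, hχ, rfl⟩, rfl⟩, fun h => hne (Circle.ext h)⟩
  rw [← h1]
  exact congrArg (Subalgebra.toSubmodule <| StarSubalgebra.toSubalgebra ·)
    (ContinuousMap.starSubalgebra_topologicalClosure_eq_top_of_separatesPoints S h2)

/-- Orthogonality of characters. -/
theorem PontryaginDual.integral_eq_zero [MeasurableSpace X] [BorelSpace X] {χ : PontryaginDual X}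
    (hχ : χ ≠ 1) : ∫ x, (χ x : ℂ) ∂(normalizedHaar X) = 0 := by
  obtain ⟨y, hy⟩ := DFunLike.ne_iff.mp hχ
  have h1 : ∫ x, (χ x : ℂ) ∂(normalizedHaar X) = (χ y : ℂ) * ∫ x, (χ x : ℂ) ∂(normalizedHaar X) := by
    rw [← integral_const_mul, ← integral_mul_left_eq_self _ y]
    simp
  have h2 : (1 - (χ y : ℂ)) * ∫ x, (χ x : ℂ) ∂(normalizedHaar X) = 0 := by
    rw [sub_mul, one_mul, ← h1, sub_self]
  refine (mul_eq_zero.mp h2).resolve_left fun h3 => hy (Circle.ext ?_)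
  rw [sub_eq_zero] at h3
  exact h3.symm

end PeterWeyl

/-! ### Independent characters map onto a torus. -/

section Torus

variable {X : Type*} [TopologicalSpace X] [CommGroup X] {ι : Type*}

/-- Joint evaluation of a finite family of characters, as a map to a torus. -/
noncomputable def charactersMap (χ : ι → PontryaginDual X) : X →* (ι → Circle) where
  toFun x i := χ i x
  map_one' := by ext; simp
  map_mul' x y := by ext; simp

theorem continuous_charactersMap (χ : ι → PontryaginDual X) : Continuous (charactersMap χ) :=
  continuous_pi fun i => map_continuous (χ i)

variable [Fintype ι]

/-- The monomial characters of a torus. -/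
noncomputable def torusMonomial (k : ι → ℤ) : PontryaginDual (ι → Circle) :=
  ({ toFun := fun c => ∏ i, c i ^ k i
     map_one' := by simp
     map_mul' := fun c e => by simp [mul_zpow, Finset.prod_mul_distrib]
     continuous_toFun := by fun_prop } : (ι → Circle) →ₜ* Circle)

theorem torusMonomial_apply (k : ι → ℤ) (c : ι → Circle) : torusMonomial k c = ∏ i, c i ^ k i := rfl

theorem PontryaginDual.prod_zpow_apply (χ : ι → PontryaginDual X) (k : ι → ℤ) (x : X) :
    (∏ i, χ i ^ k i) x = ∏ i, χ i x ^ k i := by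
  let e : PontryaginDual X →* Circle :=
    { toFun := fun ψ => ψ x, map_one' := rfl, map_mul' := fun _ _ => rfl }
  change e _ = _
  rw [map_prod]
  exact Finset.prod_congr rfl fun i _ => map_zpow e _ _

/-- The group of monomial characters of a torus. -/
noncomputable def torusMonomials (ι : Type*) [Fintype ι] : Subgroup (PontryaginDual (ι → Circle)) where
  carrier := range torusMonomial
  one_mem' := ⟨0, by ext c; simp [torusMonomial_apply]⟩
  mul_mem' := by
    rintro _ _ ⟨k, rfl⟩ ⟨l, rfl⟩
    refine ⟨k + l, PontryaginDual.ext fun c => ?_⟩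
    change _ = torusMonomial k c * torusMonomial l c
    simp [torusMonomial_apply, zpow_add, Finset.prod_mul_distrib]
  inv_mem' := by
    rintro _ ⟨k, rfl⟩
    refine ⟨-k, PontryaginDual.ext fun c => ?_⟩
    change _ = (torusMonomial k c)⁻¹
    simp [torusMonomial_apply]

theorem torusMonomials_separates (x y : ι → Circle) (h : x ≠ y) :
    ∃ χ ∈ torusMonomials ι, χ x ≠ χ y := by
  classical
  obtain ⟨i, hi⟩ := Function.ne_iff.mp h
  refine ⟨_, ⟨Pi.single i 1, rfl⟩, ?_⟩
  have key : ∀ c : ι → Circle, torusMonomial (Pi.single i 1) c = c i := by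
    intro c
    rw [torusMonomial_apply, Finset.prod_eq_single i]
    · simp
    · intro j _ hj
      simp [hj]
    · simp
  rwa [key, key]

variable [IsTopologicalGroup X] [CompactSpace X]

theorem continuous_integral_comp [MeasurableSpace X] [BorelSpace X] {Y : Type*} [TopologicalSpace Y]
    [CompactSpace Y] (g : C(X, Y)) :
    Continuous fun F : C(Y, ℂ) => ∫ x, F (g x) ∂(normalizedHaar X) := by
  refine (LipschitzWith.of_dist_le_mul (K := 1) fun F G => ?_).continuous
  rw [dist_eq_norm, dist_eq_norm, ← integral_sub
    (Continuous.integrable_normalizedHaar (by fun_prop))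
    (Continuous.integrable_normalizedHaar (by fun_prop))]
  refine (norm_integral_le_of_norm_le_const (C := ‖F - G‖)
    (Eventually.of_forall fun y => (F - G).norm_coe_le_norm (g y))).trans (by simp)

/-- Independent characters of a compact abelian group map it onto the torus. -/
theorem charactersMap_surjective {χ : ι → PontryaginDual X}
    (hχ : ∀ k : ι → ℤ, ∏ i, χ i ^ k i = 1 → k = 0) : Function.Surjective (charactersMap χ) := by
  borelize X
  intro c
  by_contra hc
  let g₁ : C(X, ι → Circle) := ⟨charactersMap χ, continuous_charactersMap χ⟩
  let g₂ : C(X, ι → Circle) := ⟨fun x => c * charactersMap χ x,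
    continuous_const.mul (continuous_charactersMap χ)⟩
  -- The functions with equal averages over the image and over its translate by `c`. Nontrivial
  -- monomials average to `0` over both, so `M` is everything by density; a bump at `c` vanishing on
  -- the image then gives a contradiction.
  let M : Submodule ℂ C(ι → Circle, ℂ) :=
    { carrier := {F | ∫ x, F (g₂ x) ∂(normalizedHaar X) = ∫ x, F (g₁ x) ∂(normalizedHaar X)}
      zero_mem' := by simp
      add_mem' := by
        intro F G hF hG
        change ∫ x, (F (g₂ x) + G (g₂ x)) ∂_ = ∫ x, (F (g₁ x) + G (g₁ x)) ∂_
        rw [integral_add (Continuous.integrable_normalizedHaar (by fun_prop))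
          (Continuous.integrable_normalizedHaar (by fun_prop)),
          integral_add (Continuous.integrable_normalizedHaar (by fun_prop))
          (Continuous.integrable_normalizedHaar (by fun_prop)), hF, hG]
      smul_mem' := by
        intro a F hF
        change ∫ x, (a * F (g₂ x)) ∂_ = ∫ x, (a * F (g₁ x)) ∂_
        rw [integral_const_mul, integral_const_mul, hF] }
  have hM : M = ⊤ := by
    rw [eq_top_iff, ← PontryaginDual.span_closure_eq_top _ torusMonomials_separates]
    refine Submodule.topologicalClosure_minimal _ (Submodule.span_le.mpr ?_)
      (isClosed_eq (continuous_integral_comp g₂) (continuous_integral_comp g₁))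
    rintro _ ⟨_, ⟨k, rfl⟩, rfl⟩
    change ∫ x, (torusMonomial k (c * charactersMap χ x) : ℂ) ∂_ =
      ∫ x, (torusMonomial k (charactersMap χ x) : ℂ) ∂_
    by_cases hk : k = 0
    · simp [hk, torusMonomial_apply]
    · have h1 : ∀ x, torusMonomial k (charactersMap χ x) = (∏ i, χ i ^ k i) x := fun x =>
        (PontryaginDual.prod_zpow_apply χ k x).symm
      have h2 := PontryaginDual.integral_eq_zero (χ := ∏ i, χ i ^ k i) fun h => hk (hχ k h)
      simp only [map_mul, Circle.coe_mul, integral_const_mul, h1, h2, mul_zero]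
  obtain ⟨f, hf0, hf1, hf⟩ := exists_continuous_zero_one_of_isClosed
    (isCompact_range (continuous_charactersMap χ)).isClosed (isClosed_singleton (x := c))
    (by simpa using hc)
  have h1 : (⟨fun z => (f z : ℂ), by fun_prop⟩ : C(ι → Circle, ℂ)) ∈ M := hM ▸ trivial
  change ∫ x, (f (c * charactersMap χ x) : ℂ) ∂_ = ∫ x, (f (charactersMap χ x) : ℂ) ∂_ at h1
  have h2 : ∀ x, f (charactersMap χ x) = 0 := fun x => hf0 ⟨x, rfl⟩
  simp only [h2, Complex.ofReal_zero, integral_zero, integral_complex_ofReal,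
    Complex.ofReal_eq_zero] at h1
  refine h1.not_gt ?_
  have h3 : Continuous fun x => f (c * charactersMap χ x) := by
    have := continuous_charactersMap χ
    fun_prop
  refine h3.integral_pos_of_hasCompactSupport_nonneg_nonzero
    (HasCompactSupport.of_compactSpace _) (fun y => (hf _).1) (x := 1) ?_
  rw [map_one, mul_one, hf1 rfl]
  exact one_ne_zero

/-- Near the identity one finds points at which only one of several independent characters is
nontrivial. -/
theorem exists_mem_nhds_one_of_independent {χ : ι → PontryaginDual X}
    (hχ : ∀ k : ι → ℤ, ∏ i, χ i ^ k i = 1 → k = 0) {W : Set X} (hW : W ∈ 𝓝 1) (j : ι) :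
    ∃ g ∈ W, χ j g ≠ 1 ∧ ∀ c ≠ j, χ c g = 1 := by
  classical
  -- A continuous surjective homomorphism from a compact group onto the torus is open, so small
  -- points of one coordinate circle lift into `W`.
  have h1 : charactersMap χ '' W ∈ 𝓝 (1 : ι → Circle) := by
    have := ((charactersMap χ).isOpenMap_of_sigmaCompact (charactersMap_surjective hχ)
      (continuous_charactersMap χ)).image_mem_nhds hW
    rwa [map_one] at this
  have h2 : Continuous fun t : ℝ => Function.update (1 : ι → Circle) j (Circle.exp t) :=
    continuous_const.update j (map_continuous Circle.exp)
  have h3 : ∀ᶠ t : ℝ in 𝓝 0, Function.update (1 : ι → Circle) j (Circle.exp t) ∈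
      charactersMap χ '' W := by
    have h3 := h2.tendsto 0
    rw [show Function.update (1 : ι → Circle) j (Circle.exp 0) = 1 by simp] at h3
    exact h3.eventually_mem h1
  have h4 : ∀ᶠ t : ℝ in 𝓝[>] 0, t ∈ Ioo (0 : ℝ) Real.pi :=
    Ioo_mem_nhdsGT Real.pi_pos
  obtain ⟨t, ⟨g, hg, hgt⟩, ht⟩ := ((h3.filter_mono nhdsWithin_le_nhds).and h4).exists
  refine ⟨g, hg, ?_, fun c hc => ?_⟩
  · have h5 : χ j g = Circle.exp t := by simpa [charactersMap] using congrFun hgt j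
    rw [h5]
    intro h6
    have h7 := Circle.arg_exp (by linarith [ht.1, Real.pi_pos] : -Real.pi < t) ht.2.le
    rw [h6] at h7
    simp at h7
    exact ht.1.ne h7
  · simpa [charactersMap, hc] using congrFun hgt c

end Torus

/-! ### Coloured refinements of open covers. -/

section Coverings

/-- Ostrand's decomposition: a finite open cover of a normal space of covering dimension at most `d`
is refined by `d + 1` finite families of pairwise disjoint open sets that together cover. -/
theorem CoveringDimLE.exists_disjoint_families {X : Type*} [TopologicalSpace X] [CompactSpace X]
    [T2Space X] {d : ℕ} (hX : CoveringDimLE X d) {𝒰 : Set (Set X)} (hfin : 𝒰.Finite)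
    (ho : ∀ U ∈ 𝒰, IsOpen U) (hcov : ⋃₀ 𝒰 = univ) :
    ∃ A : ℕ → Set (Set X), (∀ c, (A c).Finite) ∧ (∀ c, ∀ V ∈ A c, IsOpen V) ∧
      (∀ c, ∀ V ∈ A c, ∃ U ∈ 𝒰, V ⊆ U) ∧ (∀ c, (A c).PairwiseDisjoint id) ∧
      ∀ x, ∃ c ≤ d, ∃ V ∈ A c, x ∈ V := by
  classical
  obtain ⟨𝒱, hVfin, hVo, hVcov, hVU, hord⟩ := hX 𝒰 hfin ho hcov
  have : Finite 𝒱 := hVfin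
  have : Fintype 𝒱 := Fintype.ofFinite 𝒱
  obtain ⟨ρ, hρ⟩ := PartitionOfUnity.exists_isSubordinate (isClosed_univ (X := X))
    (fun V : 𝒱 => (V : Set X)) (fun V => hVo V V.2) (by rw [← sUnion_eq_iUnion, hVcov])
  have hmem : ∀ (V : 𝒱) x, 0 < ρ V x → x ∈ (V : Set X) := fun V x hx =>
    hρ V (subset_tsupport _ hx.ne')
  -- The points where the functions indexed by `J` are positive and strictly dominate all others.
  -- Distinct sets `J` of equal size cannot both dominate, so the colour is given by the size.
  let B : Finset 𝒱 → Set X := fun J =>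
    {x | ∀ i ∈ J, 0 < ρ i x ∧ ∀ k, k ∉ J → ρ k x < ρ i x}
  have hB : ∀ J, IsOpen (B J) := by
    intro J
    have h1 : B J = ⋂ i ∈ J, ({x | 0 < ρ i x} ∩ ⋂ k ∈ Jᶜ, {x | ρ k x < ρ i x}) := by
      ext x
      simp [B]
    rw [h1]
    refine isOpen_biInter_finset fun i _ => (isOpen_lt continuous_const (ρ i).continuous).inter
      (isOpen_biInter_finset fun k _ => isOpen_lt (ρ k).continuous (ρ i).continuous)
  refine ⟨fun c => B '' {J | J.card = c + 1}, fun c => (Set.toFinite _).image B, ?_, ?_, ?_, ?_⟩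
  · rintro c _ ⟨J, -, rfl⟩
    exact hB J
  · rintro c _ ⟨J, hJ, rfl⟩
    obtain ⟨i, hi⟩ := Finset.card_pos.mp (by rw [hJ]; omega : 0 < J.card)
    obtain ⟨U, hU, hiU⟩ := hVU i i.2
    exact ⟨U, hU, fun x hx => hiU (hmem i x (hx i hi).1)⟩
  · rintro c _ ⟨J, hJ, rfl⟩ _ ⟨J', hJ', rfl⟩ hne
    have hJJ : J ≠ J' := fun h => hne (h ▸ rfl)
    have hcard : J.card = J'.card := hJ.trans hJ'.symm
    obtain ⟨i, hi, hi'⟩ := Finset.not_subset.mp fun h =>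
      hJJ (Finset.eq_of_subset_of_card_le h hcard.ge)
    obtain ⟨k, hk, hk'⟩ := Finset.not_subset.mp fun h =>
      hJJ (Finset.eq_of_subset_of_card_le h hcard.le).symm
    refine Set.disjoint_left.mpr fun x hx hx' => ?_
    exact lt_asymm ((hx i hi).2 k hk') ((hx' k hk).2 i hi')
  · intro x
    let J : Finset 𝒱 := Finset.univ.filter fun i => 0 < ρ i x
    have hJ0 : 0 < J.card := by
      obtain ⟨i, hi⟩ := ρ.exists_pos (mem_univ x)
      exact Finset.card_pos.mpr ⟨i, by simpa [J] using hi⟩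
    have hJd : J.card ≤ d + 1 := by
      refine le_trans ?_ (hord x)
      rw [← Finset.card_image_of_injective J Subtype.val_injective, ← Set.ncard_coe_finset]
      refine Set.ncard_le_ncard ?_ (hVfin.subset fun V hV => hV.1)
      intro V hV
      simp only [Finset.coe_image, mem_image, Finset.mem_coe] at hV
      obtain ⟨i, hi, rfl⟩ := hV
      exact ⟨i.2, hmem i x (by simpa [J] using hi)⟩
    refine ⟨J.card - 1, by omega, B J, ⟨J, by simp only [mem_ofPred_eq]; omega, rfl⟩, ?_⟩
    intro i hi
    have hi' : 0 < ρ i x := by simpa [J] using hi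
    refine ⟨hi', fun k hk => ?_⟩
    have hk' : ¬ 0 < ρ k x := by simpa [J] using hk
    exact (not_lt.mp hk').trans_lt hi'

/-- A Lebesgue neighbourhood for an open cover of a compact group. -/
theorem exists_nhds_one_forall_mul_mem {X : Type*} [TopologicalSpace X] [Monoid X] [ContinuousMul X]
    [CompactSpace X] {𝒞 : Set (Set X)} (ho : ∀ V ∈ 𝒞, IsOpen V) (hcov : ∀ x, ∃ V ∈ 𝒞, x ∈ V) :
    ∃ W ∈ 𝓝 (1 : X), ∀ x, ∃ V ∈ 𝒞, ∀ w ∈ W, x * w ∈ V := by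
  have := isCompact_univ (X := X) |>.induction_on
    (p := fun s => ∃ W ∈ 𝓝 (1 : X), ∀ x ∈ s, ∃ V ∈ 𝒞, ∀ w ∈ W, x * w ∈ V)
    ⟨univ, univ_mem, by simp⟩
    (fun s t hst ⟨W, hW, h⟩ => ⟨W, hW, fun x hx => h x (hst hx)⟩)
    (fun s t ⟨W, hW, h⟩ ⟨W', hW', h'⟩ => ⟨W ∩ W', inter_mem hW hW', fun x hx => hx.elim
      (fun hx => (h x hx).imp fun V hV => ⟨hV.1, fun w hw => hV.2 w hw.1⟩)
      (fun hx => (h' x hx).imp fun V hV => ⟨hV.1, fun w hw => hV.2 w hw.2⟩)⟩)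
    (fun x _ => by
      obtain ⟨V, hV, hx⟩ := hcov x
      have h1 : (fun p : X × X => p.1 * p.2) ⁻¹' V ∈ 𝓝 (x, (1 : X)) :=
        continuous_mul.continuousAt.preimage_mem_nhds
          ((ho V hV).mem_nhds (by simpa using hx))
      obtain ⟨N, hN, W, hW, hNW⟩ := mem_nhds_prod_iff.mp h1
      exact ⟨N, mem_nhdsWithin_of_mem_nhds hN, W, hW, fun y hy =>
        ⟨V, hV, fun w hw => hNW (mk_mem_prod hy hw)⟩⟩)
  obtain ⟨W, hW, h⟩ := this
  exact ⟨W, hW, fun x => h x (mem_univ x)⟩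

end Coverings

/-! ### Cup products of cocycles on cubes and their integrals. -/

section CubicalCup

variable {X : Type*} [CommGroup X]

/-- The alternating cup product `ω 0 ∪ ⋯ ∪ ω (k - 1)` of function-valued `1`-cochains on a commutative
group, evaluated on the `k`-cube at `x` with edges `g`. -/
def cubicalCup (ω : ℕ → X → X → ℝ) : (k : ℕ) → (Fin k → X) → X → ℝ
  | 0, _, _ => 1
  | k + 1, g, x => ∑ j : Fin (k + 1), (-1) ^ (j : ℕ) *
      (cubicalCup ω k (fun i => g (j.succAbove i)) x * ω k (g j) (x * ∏ i, g (j.succAbove i)))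

/-- A pair `(j, l)` encodes the deletion of two indices in a given order. Reversing the order is an
involution that flips the sign and, by `hF`, preserves `F`. -/
theorem Fin.sum_eq_zero_of_antisymm {k : ℕ} (F : Fin (k + 2) → Fin (k + 1) → ℝ)
    (hF : ∀ j l, F (j.succAbove l) (l.predAbove j) = F j l) :
    ∑ j : Fin (k + 2), ∑ l : Fin (k + 1), (-1) ^ (j + l : ℕ) * F j l = 0 := by
  have h1 : ∑ p : Fin (k + 2) × Fin (k + 1), (-1 : ℝ) ^ (p.1 + p.2 : ℕ) * F p.1 p.2 =
      ∑ p : Fin (k + 2) × Fin (k + 1), -((-1) ^ (p.1 + p.2 : ℕ) * F p.1 p.2) := by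
    let σ : Fin (k + 2) × Fin (k + 1) → Fin (k + 2) × Fin (k + 1) :=
      fun p => (p.1.succAbove p.2, p.2.predAbove p.1)
    have hσ : Function.Involutive σ := fun p =>
      Prod.ext (Fin.succAbove_succAbove_predAbove _ _) (Fin.predAbove_predAbove_succAbove _ _)
    rw [← hσ.bijective.sum_comp]
    refine Finset.sum_congr rfl fun p _ => ?_
    simp only [σ]
    rw [hF, Fin.neg_one_pow_succAbove_add_predAbove, neg_mul]
  rw [← Finset.sum_product', Finset.univ_product_univ]
  rw [Finset.sum_neg_distrib] at h1
  linarith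

/-- Leibniz rule: the increments of the last factor cancel in pairs by the cocycle identity `hω`
(`h1`). The increments of the first `k` factors cancel against their swapped counterparts (`h2`),
whose sum vanishes by induction (`h3`). -/
theorem cubicalCup_closed {ω : ℕ → X → X → ℝ}
    (hω : ∀ c g h x, ω c h (x * g) - ω c h x = ω c g (x * h) - ω c g x) (k : ℕ)
    (g : Fin (k + 1) → X) (x : X) :
    ∑ j : Fin (k + 1), (-1) ^ (j : ℕ) * (cubicalCup ω k (fun i => g (j.succAbove i)) (x * g j) -
      cubicalCup ω k (fun i => g (j.succAbove i)) x) = 0 := by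
  induction k with
  | zero => simp [cubicalCup]
  | succ k ih =>
    let A : Fin (k + 2) → Fin (k + 1) → X → ℝ := fun j l =>
      cubicalCup ω k (fun i => g (j.succAbove (l.succAbove i)))
    let R : Fin (k + 2) → Fin (k + 1) → X := fun j l => ∏ i, g (j.succAbove (l.succAbove i))
    have hA : ∀ j l, A (j.succAbove l) (l.predAbove j) = A j l := fun j l => by
      simp only [A, Fin.succAbove_succAbove_succAbove_predAbove]
    have hR : ∀ j l, R (j.succAbove l) (l.predAbove j) = R j l := fun j l => by
      simp only [R, Fin.succAbove_succAbove_succAbove_predAbove]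
    have hRg : ∀ j l, R j l * g (j.succAbove l) = ∏ i, g (j.succAbove i) := fun j l => by
      simp only [R]
      rw [Fin.prod_univ_succAbove (fun i => g (j.succAbove i)) l, mul_comm]
    have h1 : ∑ j : Fin (k + 2), ∑ l : Fin (k + 1), (-1) ^ (j + l : ℕ) *
        (A j l x * (ω k (g (j.succAbove l)) (x * g j * R j l) -
          ω k (g (j.succAbove l)) (x * R j l))) = 0 := by
      refine Fin.sum_eq_zero_of_antisymm _ fun j l => ?_
      rw [hA, hR, Fin.succAbove_succAbove_predAbove, mul_right_comm, hω k,
        mul_right_comm x (R j l)]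
    have h2 : ∑ j : Fin (k + 2), ∑ l : Fin (k + 1), (-1) ^ (j + l : ℕ) *
        ((A j l (x * g j) - A j l x) * ω k (g (j.succAbove l)) (x * g j * R j l) +
          (A j l (x * g (j.succAbove l)) - A j l x) * ω k (g j) (x * g (j.succAbove l) * R j l))
        = 0 := by
      refine Fin.sum_eq_zero_of_antisymm _ fun j l => ?_
      rw [hA, hR, Fin.succAbove_succAbove_predAbove, add_comm]
    have h3 : ∑ j : Fin (k + 2), ∑ l : Fin (k + 1), (-1) ^ (j + l : ℕ) *
        ((A j l (x * g (j.succAbove l)) - A j l x) * ω k (g j) (x * g (j.succAbove l) * R j l))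
        = 0 := by
      refine Finset.sum_eq_zero fun j _ => ?_
      have h4 := ih (fun i => g (j.succAbove i))
      have h5 : ∀ l : Fin (k + 1), (-1) ^ (j + l : ℕ) *
          ((A j l (x * g (j.succAbove l)) - A j l x) * ω k (g j) (x * g (j.succAbove l) * R j l)) =
          (-1) ^ (j : ℕ) * ω k (g j) (x * ∏ i, g (j.succAbove i)) *
          ((-1) ^ (l : ℕ) * (A j l (x * g (j.succAbove l)) - A j l x)) := by
        intro l
        rw [← hRg j l, mul_comm (R j l), ← mul_assoc x, pow_add]
        ring
      rw [Finset.sum_congr rfl fun l _ => h5 l, ← Finset.mul_sum]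
      exact mul_eq_zero_of_right _ h4
    have h6 : ∀ j : Fin (k + 2), (-1) ^ (j : ℕ) *
        (cubicalCup ω (k + 1) (fun i => g (j.succAbove i)) (x * g j) -
          cubicalCup ω (k + 1) (fun i => g (j.succAbove i)) x) =
        ∑ l : Fin (k + 1), (-1) ^ (j + l : ℕ) *
          ((A j l (x * g j) - A j l x) * ω k (g (j.succAbove l)) (x * g j * R j l) +
          A j l x * (ω k (g (j.succAbove l)) (x * g j * R j l) -
          ω k (g (j.succAbove l)) (x * R j l))) := by
      intro j
      simp only [cubicalCup]
      rw [← Finset.sum_sub_distrib, Finset.mul_sum]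
      refine Finset.sum_congr rfl fun l _ => ?_
      rw [pow_add]
      simp only [A, R]
      ring
    rw [Finset.sum_congr rfl fun j _ => h6 j]
    simp only [mul_add, Finset.sum_add_distrib] at h2 ⊢
    linarith

/-- Every term of the expanded product contains a factor `ω c` evaluated along an edge at a vertex
of the cube; `m` counts the factors after it. -/
theorem cubicalCup_eq_zero {ω : ℕ → X → X → ℝ} {x : X} {c : ℕ} (m : ℕ) (g : Fin (c + 1 + m) → X)
    (h : ∀ (S : Finset (Fin (c + 1 + m))) (j : Fin (c + 1 + m)), ω c (g j) (x * ∏ i ∈ S, g i) = 0) :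
    cubicalCup ω (c + 1 + m) g x = 0 := by
  induction m with
  | zero =>
    refine Finset.sum_eq_zero fun j _ => ?_
    have := h (Finset.univ.map j.succAboveEmb) j
    rw [Finset.prod_map] at this
    simp only [Nat.add_zero, Fin.coe_succAboveEmb] at this
    rw [this, mul_zero, mul_zero]
  | succ m ih =>
    refine Finset.sum_eq_zero fun j _ => ?_
    refine mul_eq_zero_of_right _ (mul_eq_zero_of_left (ih (fun i => g (j.succAbove i))
      fun S l => ?_) _)
    have := h (S.map j.succAboveEmb) (j.succAbove l)
    rwa [Finset.prod_map] at this

theorem cubicalCup_eq_zero_of_lt {ω : ℕ → X → X → ℝ} {x : X} {c n : ℕ} (hc : c < n) (g : Fin n → X)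
    (h : ∀ (S : Finset (Fin n)) (j : Fin n), ω c (g j) (x * ∏ i ∈ S, g i) = 0) :
    cubicalCup ω n g x = 0 := by
  obtain ⟨m, rfl⟩ := Nat.exists_eq_add_of_le (Nat.succ_le_of_lt hc)
  exact cubicalCup_eq_zero m g h

/-- The `1`-cocycle `g ↦ θ g - (f (x g) - f x)`, a constant family minus a coboundary. -/
def shiftedCocycle (θ f : ℕ → X → ℝ) (c : ℕ) (g x : X) : ℝ := θ c g - (f c (x * g) - f c x)

theorem shiftedCocycle_comm (θ f : ℕ → X → ℝ) (c : ℕ) (g h x : X) :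
    shiftedCocycle θ f c h (x * g) - shiftedCocycle θ f c h x =
      shiftedCocycle θ f c g (x * h) - shiftedCocycle θ f c g x := by
  simp only [shiftedCocycle, mul_right_comm x g h]
  ring

theorem exists_bound_cubicalCup (θ : ℕ → X → ℝ) {f : ℕ → X → ℝ} (hb : ∀ c, ∃ C, ∀ x, ‖f c x‖ ≤ C)
    (k : ℕ) (g : Fin k → X) : ∃ C, ∀ x, ‖cubicalCup (shiftedCocycle θ f) k g x‖ ≤ C := by
  induction k with
  | zero => exact ⟨1, fun x => by simp [cubicalCup]⟩
  | succ k ih =>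
    obtain ⟨D, hD⟩ := hb k
    choose C hC using fun j : Fin (k + 1) => ih (fun i => g (j.succAbove i))
    refine ⟨∑ j, C j * (‖θ k (g j)‖ + (D + D)), fun x => norm_sum_le_of_le _ fun j _ => ?_⟩
    rw [norm_mul, norm_pow, norm_neg, norm_one, one_pow, one_mul, norm_mul]
    refine mul_le_mul (hC j x) ?_ (norm_nonneg _) ((norm_nonneg _).trans (hC j x))
    exact (norm_sub_le _ _).trans (by gcongr; exact (norm_sub_le _ _).trans (add_le_add (hD _) (hD _)))

variable [TopologicalSpace X] [IsTopologicalGroup X] [MeasurableSpace X] [BorelSpace X]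

theorem measurable_cubicalCup (θ : ℕ → X → ℝ) {f : ℕ → X → ℝ} (hf : ∀ c, Measurable (f c)) (k : ℕ)
    (g : Fin k → X) : Measurable (cubicalCup (shiftedCocycle θ f) k g) := by
  induction k with
  | zero => exact measurable_const
  | succ k ih =>
    refine Finset.measurable_fun_sum _ fun j _ => ((ih _).mul ?_).const_mul _
    exact ((((hf k).comp (measurable_mul_const _)).sub (hf k)).const_sub _).comp
      (measurable_mul_const _)

variable [CompactSpace X]

/-- Summation by parts: by invariance, the coboundary part of the last factor becomes an increment
of `A j` times `f k (x * P)`. Since `P` is the product of all edges, this weight does not depend on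
`j`, and closedness kills the alternating sum; only the constant `θ k` survives. -/
theorem integral_cubicalCup_succ (θ : ℕ → X → ℝ) {f : ℕ → X → ℝ} (hf : ∀ c, Measurable (f c))
    (hb : ∀ c, ∃ C, ∀ x, ‖f c x‖ ≤ C) (k : ℕ) (g : Fin (k + 1) → X) :
    ∫ x, cubicalCup (shiftedCocycle θ f) (k + 1) g x ∂(normalizedHaar X) =
      ∑ j : Fin (k + 1), (-1) ^ (j : ℕ) * (θ k (g j) *
        ∫ x, cubicalCup (shiftedCocycle θ f) k (fun i => g (j.succAbove i)) x
          ∂(normalizedHaar X)) := by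
  obtain ⟨D, hD⟩ := hb k
  set A : Fin (k + 1) → X → ℝ := fun j =>
    cubicalCup (shiftedCocycle θ f) k (fun i => g (j.succAbove i)) with hA
  let P : X := ∏ i, g i
  have hP : ∀ j : Fin (k + 1), (∏ i, g (j.succAbove i)) * g j = P := fun j => by
    simp only [P]
    rw [Fin.prod_univ_succAbove g j, mul_comm]
  have hAm : ∀ j, Measurable (A j) := fun j => measurable_cubicalCup θ hf k _
  have hAi : ∀ j y, Integrable (fun x => A j (x * y)) (normalizedHaar X) := fun j y => by
    obtain ⟨C, hC⟩ := exists_bound_cubicalCup θ hb k (fun i => g (j.succAbove i))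
    exact Integrable.of_bound ((hAm j).comp (measurable_mul_const y)).aestronglyMeasurable C
      (Eventually.of_forall fun x => hC _)
  have hAi' : ∀ j, Integrable (A j) (normalizedHaar X) := fun j => by simpa using hAi j 1
  have hfm : ∀ y, Measurable fun x => f k (x * y) := fun y => (hf k).comp (measurable_mul_const y)
  have hAf : ∀ j y z, Integrable (fun x => A j (x * y) * f k (x * z)) (normalizedHaar X) :=
    fun j y z => (hAi j y).mul_bdd (c := D) (hfm z).aestronglyMeasurable
      (Eventually.of_forall fun x => hD _)
  have hAf' : ∀ j z, Integrable (fun x => A j x * f k (x * z)) (normalizedHaar X) :=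
    fun j z => by simpa using hAf j 1 z
  have h1 : ∀ j : Fin (k + 1), ∫ x, A j x * shiftedCocycle θ f k (g j)
      (x * ∏ i, g (j.succAbove i)) ∂(normalizedHaar X) =
      θ k (g j) * ∫ x, A j x ∂(normalizedHaar X) +
        ∫ x, (A j (x * g j) - A j x) * f k (x * P) ∂(normalizedHaar X) := by
    intro j
    have h2 : ∫ x, A j (x * g j) * f k (x * P) ∂(normalizedHaar X) =
        ∫ x, A j x * f k (x * ∏ i, g (j.succAbove i)) ∂(normalizedHaar X) := by
      rw [← integral_mul_right_eq_self
        (fun x => A j x * f k (x * ∏ i, g (j.succAbove i))) (g j)]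
      refine integral_congr_ae (Eventually.of_forall fun x => ?_)
      simp only
      rw [mul_assoc x (g j), mul_comm (g j) (∏ i, _), hP]
    have h3 : ∀ x, A j x * shiftedCocycle θ f k (g j) (x * ∏ i, g (j.succAbove i)) =
        θ k (g j) * A j x - A j x * f k (x * P) + A j x * f k (x * ∏ i, g (j.succAbove i)) := by
      intro x
      rw [shiftedCocycle, mul_assoc x, hP]
      ring
    have h4 : Integrable (fun x => θ k (g j) * A j x - A j x * f k (x * P)) (normalizedHaar X) :=
      ((hAi' j).const_mul _).sub (hAf' j P)
    simp only [h3, sub_mul]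
    rw [integral_add h4 (hAf' j _),
      integral_sub ((hAi' j).const_mul _) (hAf' j P), integral_sub (hAf j _ P) (hAf' j P),
      integral_const_mul, h2]
    ring
  have h4 : ∑ j : Fin (k + 1), (-1) ^ (j : ℕ) *
      ∫ x, (A j (x * g j) - A j x) * f k (x * P) ∂(normalizedHaar X) = 0 := by
    simp only [← integral_const_mul]
    rw [← integral_finsetSum]
    · rw [← integral_zero X ℝ (μ := normalizedHaar X)]
      refine integral_congr_ae (Eventually.of_forall fun x => ?_)
      simp only [← mul_assoc]
      rw [← Finset.sum_mul, cubicalCup_closed (shiftedCocycle_comm θ f) k g x, zero_mul]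
    · intro j _
      simp only [sub_mul]
      exact ((hAf j _ P).sub (hAf' j P)).const_mul _
  simp only [cubicalCup]
  rw [integral_finsetSum]
  · simp only [integral_const_mul]
    rw [Finset.sum_congr rfl fun j _ => by rw [h1 j, mul_add], Finset.sum_add_distrib, h4, add_zero]
  · intro j _
    obtain ⟨C, hC⟩ := exists_bound_cubicalCup θ hb k (fun i => g (j.succAbove i))
    refine ((hAi' j).mul_bdd (c := ‖θ k (g j)‖ + (D + D)) ?_
      (Eventually.of_forall fun x => ?_)).const_mul _
    · exact ((((hf k).comp (measurable_mul_const _)).sub (hf k)).const_sub _).comp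
        (measurable_mul_const _) |>.aestronglyMeasurable
    · exact (norm_sub_le _ _).trans
        (by gcongr; exact (norm_sub_le _ _).trans (add_le_add (hD _) (hD _)))

/-- The matrix `θ c (G j)` is triangular, so at each stage only the last edge contributes, and the
integral is up to sign the product of the diagonal entries. -/
theorem integral_cubicalCup_ne_zero {θ f : ℕ → X → ℝ} (hf : ∀ c, Measurable (f c))
    (hb : ∀ c, ∃ C, ∀ x, ‖f c x‖ ≤ C) {G : ℕ → X} {n : ℕ} (h0 : ∀ c < n, ∀ j < c, θ c (G j) = 0)
    (h1 : ∀ c < n, θ c (G c) ≠ 0) :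
    ∫ x, cubicalCup (shiftedCocycle θ f) n (fun i => G i) x ∂(normalizedHaar X) ≠ 0 := by
  induction n with
  | zero => simp [cubicalCup]
  | succ n ih =>
    rw [integral_cubicalCup_succ θ hf hb, Finset.sum_eq_single (Fin.last n)]
    · refine mul_ne_zero (pow_ne_zero _ (by norm_num)) (mul_ne_zero (h1 n n.lt_succ_self) ?_)
      simpa using ih (fun c hc => h0 c (hc.trans n.lt_succ_self))
        (fun c hc => h1 c (hc.trans n.lt_succ_self))
    · intro j _ hj
      rw [h0 n n.lt_succ_self j (Fin.val_lt_last hj), zero_mul, mul_zero]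
    · simp

end CubicalCup

/-! ### Covering dimension bounds the rank of the dual. -/

section FiniteRank

theorem Circle.arg_mul_of_re_pos {u v : Circle} (hu : 0 < (u : ℂ).re) (hv : 0 < (v : ℂ).re) :
    Complex.arg ((u * v : Circle) : ℂ) = Complex.arg u + Complex.arg v := by
  rw [Circle.coe_mul, Complex.arg_mul_eq_add_arg_iff u.coe_ne_zero v.coe_ne_zero]
  have h1 := Complex.abs_arg_lt_pi_div_two_iff.mpr (Or.inl hu)
  have h2 := Complex.abs_arg_lt_pi_div_two_iff.mpr (Or.inl hv)
  rw [abs_lt] at h1 h2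
  exact ⟨by linarith, by linarith⟩

variable {X : Type*} [TopologicalSpace X] [CommGroup X] [IsTopologicalGroup X] [CompactSpace X]

/-- A compact abelian group of covering dimension at most `d` does not have `d + 1` independent
characters. -/
theorem CoveringDimLE.not_independent [T2Space X] {d : ℕ} (hX : CoveringDimLE X d)
    (χ : Fin (d + 1) → PontryaginDual X) (hχ : ∀ k : Fin (d + 1) → ℤ, ∏ i, χ i ^ k i = 1 → k = 0) :
    False := by
  classical
  borelize X
  -- Relative to `y`, every `χ c` takes values in the right half plane on `U y`, so its argument is
  -- additive under small increments.
  let U : X → Set X := fun y => {x | ∀ c, 0 < (((χ c y)⁻¹ * χ c x : Circle) : ℂ).re}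
  have hUo : ∀ y, IsOpen (U y) := by
    intro y
    have h1 : U y = ⋂ c, {x | 0 < (((χ c y)⁻¹ * χ c x : Circle) : ℂ).re} := by ext; simp [U]
    rw [h1]
    refine isOpen_iInter_of_finite fun c => isOpen_lt continuous_const ?_
    fun_prop
  have hUm : ∀ y, y ∈ U y := fun y c => by simp
  obtain ⟨t, -, ht⟩ := isCompact_univ.elim_nhds_subcover U fun y _ => (hUo y).mem_nhds (hUm y)
  obtain ⟨A, hfin, hAo, hAU, hdisj, hcov⟩ := hX.exists_disjoint_families (𝒰 := U '' t)
    (t.finite_toSet.image U) (by rintro _ ⟨y, -, rfl⟩; exact hUo y)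
    (by rw [sUnion_image]; exact univ_subset_iff.mp ht)
  have hY : ∀ V : Set X, ∃ y, (∃ c, V ∈ A c) → V ⊆ U y := by
    intro V
    by_cases h : ∃ c, V ∈ A c
    · obtain ⟨c, hc⟩ := h
      obtain ⟨_, ⟨y, -, rfl⟩, hy⟩ := hAU c V hc
      exact ⟨y, fun _ => hy⟩
    · exact ⟨1, fun h' => absurd h' h⟩
  choose Y hY using hY
  let ψ : ℕ → PontryaginDual X := fun c => if h : c < d + 1 then χ ⟨c, h⟩ else 1
  have hψ : ∀ c (h : c < d + 1), ψ c = χ ⟨c, h⟩ := fun c h => dif_pos h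
  let θ : ℕ → X → ℝ := fun c g => Complex.arg (ψ c g)
  let b : ℕ → Set X → X → ℝ := fun c V x => Complex.arg ((ψ c (Y V))⁻¹ * ψ c x : Circle)
  -- A local logarithm of `χ c` on each member of colour `c`, unambiguous because these members are
  -- disjoint, and `0` elsewhere. It need not be continuous; measurability and boundedness suffice.
  let f : ℕ → X → ℝ := fun c x => ∑ V ∈ (hfin c).toFinset, V.indicator (b c V) x
  have hfV : ∀ c, ∀ V ∈ A c, ∀ x ∈ V, f c x = b c V x := by
    intro c V hV x hx
    simp only [f]
    rw [Finset.sum_eq_single V]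
    · exact indicator_of_mem hx _
    · intro V' hV' hne
      refine indicator_of_notMem (fun hx' => ?_) _
      exact Set.disjoint_left.mp (hdisj c ((hfin c).mem_toFinset.mp hV') hV hne) hx' hx
    · intro h
      exact absurd ((hfin c).mem_toFinset.mpr hV) h
  have hfm : ∀ c, Measurable (f c) := by
    intro c
    refine Finset.measurable_fun_sum _ fun V hV => Measurable.indicator ?_
      (hAo c V ((hfin c).mem_toFinset.mp hV)).measurableSet
    refine Complex.measurable_arg.comp (Continuous.measurable ?_)
    fun_prop
  have hfb : ∀ c, ∃ C, ∀ x, ‖f c x‖ ≤ C := by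
    intro c
    refine ⟨∑ V ∈ (hfin c).toFinset, Real.pi, fun x => norm_sum_le_of_le _ fun V _ => ?_⟩
    refine (norm_indicator_le_norm_self _ _).trans ?_
    exact Complex.abs_arg_le_pi _
  obtain ⟨W, hW, hWV⟩ := exists_nhds_one_forall_mul_mem (X := X) (𝒞 := {V | ∃ c ≤ d, V ∈ A c})
    (by rintro V ⟨c, -, hc⟩; exact hAo c V hc)
    (fun x => by obtain ⟨c, hc, V, hV, hx⟩ := hcov x; exact ⟨V, ⟨c, hc, hV⟩, hx⟩)
  have hev : ∀ᶠ g : Fin (d + 1) → X in 𝓝 1, ∀ (S : Finset (Fin (d + 1))) (j : Fin (d + 1)),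
      ∏ i ∈ S, g i ∈ W ∧ (∏ i ∈ S, g i) * g j ∈ W := by
    rw [eventually_all]
    intro S
    rw [eventually_all]
    intro j
    refine Filter.Eventually.and ?_ ?_
    · have h1 : Continuous fun g : Fin (d + 1) → X => ∏ i ∈ S, g i := by fun_prop
      have h2 := h1.tendsto 1
      simp only [Pi.one_apply, Finset.prod_const_one] at h2
      exact h2.eventually_mem hW
    · have h1 : Continuous fun g : Fin (d + 1) → X => (∏ i ∈ S, g i) * g j := by fun_prop
      have h2 := h1.tendsto 1
      simp only [Pi.one_apply, Finset.prod_const_one, mul_one] at h2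
      exact h2.eventually_mem hW
  rw [nhds_pi, Filter.Eventually, Filter.mem_pi] at hev
  obtain ⟨I, -, N, hN, hNW⟩ := hev
  have hN' : (⋂ i, N i) ∩ U 1 ∈ 𝓝 (1 : X) :=
    inter_mem (Filter.iInter_mem.mpr hN) ((hUo 1).mem_nhds (hUm 1))
  -- Only `χ j` is nontrivial on the edge `G j`, which makes `θ` diagonal; the edges are so short
  -- that every cube stays inside one member of the coloured cover.
  choose G hGN hGne hG1 using exists_mem_nhds_one_of_independent hχ hN'
  have hGW := hNW (fun i _ => mem_iInter.mp (hGN i).1 i : G ∈ I.pi N)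
  have hGU : ∀ j c, 0 < (χ c (G j) : ℂ).re := fun j c => by simpa using (hGN j).2 c
  let G' : ℕ → X := fun j => if h : j < d + 1 then G ⟨j, h⟩ else 1
  have hG' : ∀ j (h : j < d + 1), G' j = G ⟨j, h⟩ := fun j h => dif_pos h
  refine integral_cubicalCup_ne_zero (θ := θ) hfm hfb (G := G') (n := d + 1) ?_ ?_ ?_
  · intro c hc j hj
    simp only [θ]
    rw [hψ c hc, hG' j (hj.trans hc), hG1 ⟨j, hj.trans hc⟩ ⟨c, hc⟩ (by simpa using hj.ne')]
    simp
  · intro c hc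
    simp only [θ]
    rw [hψ c hc, hG' c hc]
    intro h
    refine hGne ⟨c, hc⟩ (Circle.injective_arg ?_)
    simpa using h
  · rw [← integral_zero X ℝ (μ := normalizedHaar X)]
    refine integral_congr_ae (Eventually.of_forall fun x => ?_)
    -- The cube at `x` lies in a member of some colour `c ≤ d`. There `f c` is a logarithm of `χ c`,
    -- so the factor with index `c` among the `d + 1` factors vanishes.
    obtain ⟨V, ⟨c, hc, hV⟩, hxV⟩ := hWV x
    refine cubicalCup_eq_zero_of_lt (Nat.lt_succ_of_le hc) _ fun S j => ?_
    have hGG : ∀ i : Fin (d + 1), G' i = G i := fun i => hG' i i.2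
    simp only [hGG]
    have h1 := hxV _ (hGW S j).1
    have h2 := hxV _ (hGW S j).2
    rw [← mul_assoc] at h2
    have h3 := hY V ⟨c, hV⟩ h1 ⟨c, Nat.lt_succ_of_le hc⟩
    rw [shiftedCocycle, hfV c V hV _ h1, hfV c V hV _ h2]
    simp only [b, θ]
    rw [hψ c (Nat.lt_succ_of_le hc), map_mul _ (x * _) (G j), ← mul_assoc,
      Circle.arg_mul_of_re_pos h3 (hGU j _)]
    ring

/-- The character group of a compact abelian group of finite covering dimension has finite rank. -/
theorem FiniteCoveringDim.finiteDimensional_ratDual [T2Space X] (hX : FiniteCoveringDim X) :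
    FiniteDimensional ℚ (RatDual X) := by
  obtain ⟨d, hd⟩ := hX
  let ι₁ : Additive (PontryaginDual X) →ₗ[ℤ] RatDual X :=
    TensorProduct.mk ℤ ℚ (Additive (PontryaginDual X)) 1
  have hspan : Submodule.span ℚ (range ι₁) = ⊤ := by
    rw [eq_top_iff]
    intro z _
    induction z using TensorProduct.induction_on with
    | zero => exact zero_mem _
    | tmul q m =>
      have : q ⊗ₜ[ℤ] m = q • ι₁ m := by
        change _ = q • ((1 : ℚ) ⊗ₜ[ℤ] m)
        rw [TensorProduct.smul_tmul', smul_eq_mul, mul_one]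
      rw [this]
      exact Submodule.smul_mem _ _ (Submodule.subset_span ⟨m, rfl⟩)
    | add a b ha hb => exact add_mem (ha trivial) (hb trivial)
  obtain ⟨s, hs, hspan', hli⟩ := exists_linearIndependent ℚ (range ι₁)
  by_cases hfin : s.Finite
  · exact Module.finite_def.mpr ⟨hfin.toFinset, by rw [hfin.coe_toFinset, hspan', hspan]⟩
  exfalso
  obtain ⟨F, hF, hcard⟩ := Set.Infinite.exists_subset_card_eq hfin (d + 1)
  let e : Fin (d + 1) ≃ F := (F.equivFinOfCardEq hcard).symm
  have hF' : ∀ i : Fin (d + 1), ∃ χ : Additive (PontryaginDual X), ι₁ χ = (e i : RatDual X) :=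
    fun i => hs (hF (e i).2)
  choose χ hχ using hF'
  have hli' : LinearIndependent ℚ (fun i => ι₁ (χ i)) := by
    have h1 := hli.comp (fun i : Fin (d + 1) => (⟨e i, hF (e i).2⟩ : s)) fun i j hij =>
      e.injective (Subtype.ext (congrArg (fun z : s => (z : RatDual X)) hij))
    simpa only [Function.comp_def, hχ] using h1
  refine hd.not_independent (fun i => (χ i).toMul) fun k hk => ?_
  have h1 : ∑ i, k i • χ i = 0 := congrArg Additive.ofMul hk
  have h2 : ∑ i, (k i : ℚ) • ι₁ (χ i) = 0 := by
    have := congrArg ι₁ h1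
    simpa [map_sum, Int.cast_smul_eq_zsmul] using this
  funext i
  exact_mod_cast Fintype.linearIndependent_iff.mp hli' _ h2 i

end FiniteRank

/-! ### Extending limits from characters to integrable functions. -/

section Equidistribution

variable {X : Type*} [TopologicalSpace X] [CommGroup X] [IsTopologicalGroup X] [CompactSpace X]
  [T2Space X]

theorem PontryaginDual.exists_span_norm_sub_lt (G : C(X, ℂ)) {ε : ℝ} (hε : 0 < ε) :
    ∃ p ∈ Submodule.span ℂ (range (PontryaginDual.toC (X := X))), ‖G - p‖ < ε := by
  have h1 := PontryaginDual.span_closure_eq_top (⊤ : Subgroup (PontryaginDual X)) fun x y hxy => by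
    obtain ⟨χ, hχ⟩ := exists_pontryaginDual_ne_one (x := x * y⁻¹)
      (by rwa [Ne, mul_inv_eq_one])
    refine ⟨χ, trivial, fun h => hχ ?_⟩
    rw [_root_.map_mul, _root_.map_inv, h, mul_inv_cancel]
  rw [Subgroup.coe_top, image_univ] at h1
  have h2 : G ∈ (Submodule.span ℂ (range (PontryaginDual.toC (X := X)))).topologicalClosure :=
    h1 ▸ trivial
  obtain ⟨p, hp, hGp⟩ := Metric.mem_closure_iff.mp h2 ε hε
  exact ⟨p, hp, by rwa [← dist_eq_norm]⟩

variable [MeasurableSpace X] [BorelSpace X]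

theorem PontryaginDual.exists_span_integral_sub_le {g : X → ℂ} (hg : Integrable g (normalizedHaar X))
    {ε : ℝ} (hε : 0 < ε) : ∃ p ∈ Submodule.span ℂ (range (PontryaginDual.toC (X := X))),
      ∫ x, ‖g x - p x‖ ∂(normalizedHaar X) ≤ ε := by
  obtain ⟨G, -, hG, hGc, hGi⟩ := hg.exists_hasCompactSupport_integral_sub_le (half_pos hε)
  obtain ⟨G, rfl⟩ : ∃ G' : C(X, ℂ), ⇑G' = G := ⟨⟨G, hGc⟩, rfl⟩
  obtain ⟨p, hp, hpG⟩ := PontryaginDual.exists_span_norm_sub_lt G (half_pos hε)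
  refine ⟨p, hp, ?_⟩
  have hpi : Integrable p (normalizedHaar X) := p.continuous.integrable_normalizedHaar
  have h1 : ∫ x, ‖G x - p x‖ ∂(normalizedHaar X) ≤ ε / 2 := by
    have h3 : ∀ x, ‖G x - p x‖ ≤ ε / 2 := fun x =>
      ((G - p).norm_coe_le_norm x).trans hpG.le
    have h4 := integral_mono (hGi.sub hpi).norm (integrable_const (ε / 2)) h3
    simpa using h4
  have h2 : ∫ x, ‖g x - p x‖ ∂(normalizedHaar X) ≤
      ∫ x, (‖g x - G x‖ + ‖G x - p x‖) ∂(normalizedHaar X) :=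
    integral_mono (hg.sub hpi).norm ((hg.sub hGi).norm.add (hGi.sub hpi).norm)
      fun x => norm_sub_le_norm_sub_add_norm_sub _ _ _
  have h3 := integral_add (hg.sub hGi).norm (hGi.sub hpi).norm
  simp only [Pi.sub_apply] at h3
  linarith

/-- If averages along measure-preserving maps converge for characters, they converge for all
integrable functions. -/
theorem tendsto_integral_comp_mul {S : ℕ → X → X}
    (hS : ∀ n, MeasurePreserving (S n) (normalizedHaar X) (normalizedHaar X)) {h : ℕ → X → ℂ}
    (hm : ∀ n, AEStronglyMeasurable (h n) (normalizedHaar X)) (hb : ∀ n x, ‖h n x‖ ≤ 1) {κ : ℂ}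
    (hχ : ∀ χ : PontryaginDual X,
      Tendsto (fun n => ∫ x, χ.toC (S n x) * h n x ∂(normalizedHaar X)) atTop
        (𝓝 ((∫ x, χ.toC x ∂(normalizedHaar X)) * κ)))
    {g : X → ℂ} (hg : Integrable g (normalizedHaar X)) :
    Tendsto (fun n => ∫ x, g (S n x) * h n x ∂(normalizedHaar X)) atTop
      (𝓝 ((∫ x, g x ∂(normalizedHaar X)) * κ)) := by
  have hi : ∀ {g : X → ℂ}, Integrable g (normalizedHaar X) → ∀ n,
      Integrable (fun x => g (S n x) * h n x) (normalizedHaar X) := fun hg n =>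
    ((hS n).integrable_comp_of_integrable hg).mul_bdd (c := 1) (hm n)
      (Eventually.of_forall (hb n))
  have hc : ∀ p : C(X, ℂ), Integrable p (normalizedHaar X) := fun p =>
    p.continuous.integrable_normalizedHaar
  have hp : ∀ p ∈ Submodule.span ℂ (range (PontryaginDual.toC (X := X))),
      Tendsto (fun n => ∫ x, p (S n x) * h n x ∂(normalizedHaar X)) atTop
        (𝓝 ((∫ x, p x ∂(normalizedHaar X)) * κ)) := by
    intro p hp
    induction hp using Submodule.span_induction with
    | mem p hp =>
      obtain ⟨χ, rfl⟩ := hp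
      exact hχ χ
    | zero => simp
    | add p q _ _ h1 h2 =>
      simp only [ContinuousMap.add_apply, add_mul]
      rw [integral_add (hc p) (hc q), add_mul]
      refine (h1.add h2).congr fun n => ?_
      rw [integral_add (hi (hc p) n) (hi (hc q) n)]
    | smul a p _ h1 =>
      simp only [ContinuousMap.smul_apply, smul_eq_mul, mul_assoc, integral_const_mul]
      exact h1.const_mul a
  rw [Metric.tendsto_atTop]
  intro ε hε
  -- The three errors below add up to at most `δ * (2 + ‖κ‖)`; the `3` makes the final bound strict.
  have hδ : 0 < ε / (3 + ‖κ‖) := by positivity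
  set δ := ε / (3 + ‖κ‖) with hδ_def
  obtain ⟨p, hps, hgp⟩ := PontryaginDual.exists_span_integral_sub_le hg hδ
  obtain ⟨N, hN⟩ := Metric.tendsto_atTop.mp (hp p hps) δ hδ
  refine ⟨N, fun n hn => ?_⟩
  have hgpi : Integrable (fun x => g x - p x) (normalizedHaar X) := hg.sub (hc p)
  have h1 : dist (∫ x, g (S n x) * h n x ∂(normalizedHaar X))
      (∫ x, p (S n x) * h n x ∂(normalizedHaar X)) ≤ δ := by
    rw [dist_eq_norm, ← integral_sub (hi hg n) (hi (hc p) n)]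
    refine (norm_integral_le_integral_norm _).trans (le_trans ?_ hgp)
    have h3 : ∫ x, ‖g x - p x‖ ∂(normalizedHaar X) =
        ∫ x, ‖g (S n x) - p (S n x)‖ ∂(normalizedHaar X) := by
      conv_lhs => rw [← (hS n).map_eq]
      refine integral_map (hS n).measurable.aemeasurable ?_
      rw [(hS n).map_eq]
      exact hgpi.norm.aestronglyMeasurable
    rw [h3]
    refine integral_mono ((hi hg n).sub (hi (hc p) n)).norm
      ((hS n).integrable_comp_of_integrable hgpi).norm fun x => ?_
    dsimp only
    rw [← sub_mul, norm_mul]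
    exact mul_le_of_le_one_right (norm_nonneg _) (hb n x)
  have h2 : dist ((∫ x, p x ∂(normalizedHaar X)) * κ) ((∫ x, g x ∂(normalizedHaar X)) * κ) ≤
      δ * ‖κ‖ := by
    rw [dist_comm, dist_eq_norm, ← sub_mul, norm_mul, ← integral_sub hg (hc p)]
    gcongr
    exact (norm_integral_le_integral_norm _).trans hgp
  calc dist (∫ x, g (S n x) * h n x ∂(normalizedHaar X)) ((∫ x, g x ∂(normalizedHaar X)) * κ)
      ≤ δ + δ + δ * ‖κ‖ := (dist_triangle4 _ _ _ _).trans
        (add_le_add (add_le_add h1 (hN n hn).le) h2)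
    _ < δ * (3 + ‖κ‖) := by linarith
    _ = ε := by rw [hδ_def]; field_simp

end Equidistribution

/-! ### Mixing in terms of characters. -/

section MixingCriterion

theorem PontryaginDual.iterate_map_apply {X : Type*} [TopologicalSpace X] [CommGroup X]
    (T : X →ₜ* X) (χ : PontryaginDual X) (n : ℕ) (x : X) :
    ((PontryaginDual.map T)^[n] χ) x = χ ((T : X → X)^[n] x) := by
  induction n generalizing x with
  | zero => rfl
  | succ n ih =>
    rw [Function.iterate_succ_apply', PontryaginDual.map_apply, ih, Function.iterate_succ_apply]

/-- The character `∏ i, χ i ∘ T i ^ n`. -/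
noncomputable def prodCharacter {X : Type*} [TopologicalSpace X] [CommGroup X] {ι : Type*}
    [Fintype ι] (T : ι → X →ₜ* X) (χ : ι → PontryaginDual X) (n : ℕ) :
    PontryaginDual X :=
  ∏ i, (PontryaginDual.map (T i))^[n] (χ i)

theorem prodCharacter_apply {X : Type*} [TopologicalSpace X] [CommGroup X] {ι : Type*} [Fintype ι]
    (T : ι → X →ₜ* X) (χ : ι → PontryaginDual X) (n : ℕ) (x : X) :
    prodCharacter T χ n x = ∏ i, χ i ((T i : X → X)^[n] x) := by
  have h1 := PontryaginDual.prod_zpow_apply (fun i => (PontryaginDual.map (T i))^[n] (χ i))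
    (fun _ => 1) x
  simp only [zpow_one, PontryaginDual.iterate_map_apply] at h1
  exact h1

variable {X : Type*} [TopologicalSpace X] [CommGroup X] [IsTopologicalGroup X] [CompactSpace X]
  [MeasurableSpace X] [BorelSpace X]

theorem ContinuousMonoidHom.measurePreserving_iterate {T : X →ₜ* X} (hT : Function.Surjective T)
    (n : ℕ) : MeasurePreserving (T : X → X)^[n] (normalizedHaar X) (normalizedHaar X) :=
  (MonoidHom.measurePreserving (f := T.toMonoidHom) T.continuous_toFun hT rfl).iterate n

variable {ι : Type*} [Fintype ι]

/-- Characters are replaced by general bounded functions one index at a time, `J` being the set of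
indices already replaced. The case of no replacement is orthogonality; in the step, the other
factors form a bounded weight for `tendsto_integral_comp_mul`. -/
theorem tendsto_integral_prod [T2Space X] {T : ι → X →ₜ* X} (hT : ∀ i, Function.Surjective (T i))
    (h : ∀ χ : ι → PontryaginDual X, χ ≠ 1 → ∀ᶠ n in atTop, prodCharacter T χ n ≠ 1) (J : Finset ι)
    (f : ι → X → ℂ) (hm : ∀ i, AEStronglyMeasurable (f i) (normalizedHaar X))
    (hb : ∀ i x, ‖f i x‖ ≤ 1) (hJ : ∀ i ∉ J, ∃ χ : PontryaginDual X, f i = χ.toC) :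
    Tendsto (fun n => ∫ x, ∏ i, f i ((T i : X → X)^[n] x) ∂(normalizedHaar X)) atTop
      (𝓝 (∏ i, ∫ x, f i x ∂(normalizedHaar X))) := by
  classical
  induction J using Finset.induction_on generalizing f with
  | empty =>
    choose χ hχ using fun i => hJ i (Finset.notMem_empty i)
    have h1 : ∀ n x, ∏ i, f i ((T i : X → X)^[n] x) = (prodCharacter T χ n x : ℂ) := by
      intro n x
      rw [prodCharacter_apply]
      simp only [hχ, PontryaginDual.toC_apply]
      exact (map_prod Circle.coeHom _ _).symm
    simp only [h1]
    by_cases h2 : χ = 1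
    · have h3 : ∀ n x, prodCharacter T χ n x = 1 := fun n x => by
        rw [prodCharacter_apply]
        exact Finset.prod_eq_one fun i _ => by rw [h2]; rfl
      have h4 : ∀ i x, f i x = 1 := fun i x => by rw [hχ, h2]; rfl
      simp [h3, h4]
    · obtain ⟨i, hi⟩ := Function.ne_iff.mp h2
      rw [Finset.prod_eq_zero (Finset.mem_univ i)]
      · refine tendsto_const_nhds.congr' ?_
        filter_upwards [h χ h2] with n hn
        exact (PontryaginDual.integral_eq_zero hn).symm
      · rw [hχ]
        exact PontryaginDual.integral_eq_zero hi
  | insert j J hj ih =>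
    have hsplit : ∀ (g : X → ℂ) n x, ∏ i, Function.update f j g i ((T i : X → X)^[n] x) =
        g ((T j : X → X)^[n] x) * ∏ i ∈ Finset.univ.erase j, f i ((T i : X → X)^[n] x) := by
      intro g n x
      rw [← Finset.mul_prod_erase _ _ (Finset.mem_univ j), Function.update_self]
      congr 1
      exact Finset.prod_congr rfl fun i hi => by
        rw [Function.update_of_ne (Finset.ne_of_mem_erase hi)]
    have hsplit' : ∀ (g : X → ℂ), ∏ i, ∫ x, Function.update f j g i x ∂(normalizedHaar X) =
        (∫ x, g x ∂(normalizedHaar X)) *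
          ∏ i ∈ Finset.univ.erase j, ∫ x, f i x ∂(normalizedHaar X) := by
      intro g
      rw [← Finset.mul_prod_erase _ _ (Finset.mem_univ j), Function.update_self]
      congr 1
      exact Finset.prod_congr rfl fun i hi => by
        rw [Function.update_of_ne (Finset.ne_of_mem_erase hi)]
    have hmain := tendsto_integral_comp_mul (S := fun n => (T j : X → X)^[n])
      (fun n => ContinuousMonoidHom.measurePreserving_iterate (hT j) n)
      (h := fun n x => ∏ i ∈ Finset.univ.erase j, f i ((T i : X → X)^[n] x))
      (κ := ∏ i ∈ Finset.univ.erase j, ∫ x, f i x ∂(normalizedHaar X))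
      (fun n => Finset.aestronglyMeasurable_fun_prod _ fun i _ =>
        (hm i).comp_measurePreserving (ContinuousMonoidHom.measurePreserving_iterate (hT i) n))
      (fun n x => by
        rw [norm_prod]
        exact Finset.prod_le_one (fun i _ => norm_nonneg _) fun i _ => hb i _)
      (fun χ => by
        have h1 := ih (Function.update f j χ.toC) (fun i => ?_) (fun i x => ?_) (fun i hi => ?_)
        · simpa only [hsplit, hsplit'] using h1
        · rcases eq_or_ne i j with rfl | hij
          · rw [Function.update_self]
            exact χ.toC.continuous.integrable_normalizedHaar.aestronglyMeasurable
          · rw [Function.update_of_ne hij]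
            exact hm i
        · rcases eq_or_ne i j with rfl | hij
          · rw [Function.update_self]
            exact (Circle.norm_coe _).le
          · rw [Function.update_of_ne hij]
            exact hb i x
        · rcases eq_or_ne i j with rfl | hij
          · exact ⟨χ, Function.update_self _ _ _⟩
          · rw [Function.update_of_ne hij]
            exact hJ i (by simp [hij, hi]))
      (g := f j) (Integrable.of_bound (hm j) 1 (Eventually.of_forall (hb j)))
    have h2 := hsplit (f j)
    have h3 := hsplit' (f j)
    rw [Function.update_eq_self] at h2 h3
    simpa only [h2, h3] using hmain

/-- If every nontrivial product character is eventually nontrivial, the family is mixing. -/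
theorem isMixing_of_eventually_ne_one [T2Space X] [DecidableEq (X →ₜ* X)] {T : ι → X →ₜ* X}
    (hinj : Function.Injective T) (hcard : 1 < Fintype.card ι)
    (hT : ∀ i, Function.Surjective (T i))
    (h : ∀ χ : ι → PontryaginDual X, χ ≠ 1 → ∀ᶠ n in atTop, prodCharacter T χ n ≠ 1) :
    IsMixing (Finset.univ.image T) := by
  classical
  refine ⟨by rwa [Finset.card_image_of_injective _ hinj, Finset.card_univ], fun B hB => ?_⟩
  have hB' : ∀ i, NullMeasurableSet (B (T i)) (normalizedHaar X) := fun i =>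
    hB _ (Finset.mem_image_of_mem T (Finset.mem_univ i))
  have h1 := tendsto_integral_prod hT h Finset.univ (fun i => (B (T i)).indicator fun _ => (1 : ℂ))
    (fun i => aestronglyMeasurable_const.indicator₀ (hB' i))
    (fun i x => (norm_indicator_le_norm_self _ _).trans (by simp)) (by simp)
  have h2 : ∀ {s : Set X}, NullMeasurableSet s (normalizedHaar X) →
      ∫ x, s.indicator (fun _ => (1 : ℂ)) x ∂(normalizedHaar X) =
        (((normalizedHaar X) s).toReal : ℂ) := by
    intro s hs
    rw [integral_indicator₀ hs, setIntegral_const, Measure.real]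
    simp
  have h3 : ∀ n x, ∏ i, (B (T i)).indicator (fun _ => (1 : ℂ)) ((T i : X → X)^[n] x) =
      (⋂ i, (T i : X → X)^[n] ⁻¹' B (T i)).indicator (fun _ => (1 : ℂ)) x := by
    intro n x
    by_cases hx : ∀ i, (T i : X → X)^[n] x ∈ B (T i)
    · rw [indicator_of_mem (mem_iInter.mpr hx)]
      exact Finset.prod_eq_one fun i _ => indicator_of_mem (hx i) _
    · rw [indicator_of_notMem (fun hx' => hx (mem_iInter.mp hx'))]
      push Not at hx
      obtain ⟨i, hi⟩ := hx
      exact Finset.prod_eq_zero (Finset.mem_univ i) (indicator_of_notMem hi _)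
  have h4 : ∀ n, NullMeasurableSet (⋂ i, (T i : X → X)^[n] ⁻¹' B (T i)) (normalizedHaar X) :=
    fun n => NullMeasurableSet.iInter fun i => (hB' i).preimage
      (ContinuousMonoidHom.measurePreserving_iterate (hT i) n).quasiMeasurePreserving
  simp only [h3, h2 (h4 _), h2 (hB' _), ← Complex.ofReal_prod] at h1
  rw [tendsto_ofReal_iff, ← ENNReal.toReal_prod, ENNReal.tendsto_toReal_iff
    (fun n => measure_ne_top _ _) (ENNReal.prod_ne_top fun i _ => measure_ne_top _ _)] at h1
  rw [Finset.prod_image hinj.injOn]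
  simpa using h1

theorem IsMixing.subset [DecidableEq (X →ₜ* X)] {F F' : Finset (X →ₜ* X)} (hF : IsMixing F)
    (hsub : F' ⊆ F) (hcard : 1 < F'.card) : IsMixing F' := by
  refine ⟨hcard, fun B hB => ?_⟩
  have h1 := hF.2 (fun γ => if γ ∈ F' then B γ else univ) fun γ _ => by
    by_cases hγ : γ ∈ F'
    · simpa [hγ] using hB γ hγ
    · simp [hγ]
  have h2 : ∏ γ ∈ F, normalizedHaar X (if γ ∈ F' then B γ else univ) =
      ∏ γ ∈ F', normalizedHaar X (B γ) := by
    rw [← Finset.prod_subset hsub fun γ _ hγ => by simp [hγ]]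
    exact Finset.prod_congr rfl fun γ hγ => by simp [hγ]
  have h3 : ∀ n : ℕ, ⋂ γ ∈ F, (γ : X → X)^[n] ⁻¹' (if γ ∈ F' then B γ else univ) =
      ⋂ γ ∈ F', (γ : X → X)^[n] ⁻¹' B γ := by
    intro n
    ext x
    simp only [mem_iInter, mem_preimage]
    refine ⟨fun hx γ hγ => by simpa [hγ] using hx γ (hsub hγ), fun hx γ _ => ?_⟩
    by_cases hγ : γ ∈ F'
    · simpa [hγ] using hx γ hγ
    · simp [hγ]
  rwa [h2, tendsto_congr fun n => by rw [h3 n]] at h1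

/-- A mixing pair does not satisfy `χ ∘ T ^ n = χ ∘ S ^ n` for infinitely many `n` and a nontrivial
character `χ`. -/
theorem IsMixing.eq_one_of_frequently [DecidableEq (X →ₜ* X)] {S T : X →ₜ* X}
    (h : IsMixing {S, T}) (hST : S ≠ T) {χ : PontryaginDual X}
    (hχ : ∃ᶠ n in atTop, (PontryaginDual.map S)^[n] χ = (PontryaginDual.map T)^[n] χ) : χ = 1 := by
  by_contra hne
  obtain ⟨y, hy⟩ := DFunLike.ne_iff.mp hne
  -- For infinitely many `n` the preimages of `χ ⁻¹' u` and `χ ⁻¹' v` are disjoint, while mixing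
  -- would give a positive limit.
  obtain ⟨u, v, hu, hv, hyu, h1v, huv⟩ := t2_separation hy
  have hpos : ∀ w : Set Circle, IsOpen w → ∀ x, χ x ∈ w → normalizedHaar X (χ ⁻¹' w) ≠ 0 :=
    fun w hw x hx => ((hw.preimage (map_continuous χ)).measure_pos _ ⟨x, hx⟩).ne'
  have hlim := h.2 (fun γ => if γ = S then χ ⁻¹' u else χ ⁻¹' v) fun γ _ => by
    by_cases hγ : γ = S
    · simpa [hγ] using (hu.preimage (map_continuous χ)).measurableSet.nullMeasurableSet
    · simpa [hγ] using (hv.preimage (map_continuous χ)).measurableSet.nullMeasurableSet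
  rw [Finset.prod_pair hST, if_pos rfl, if_neg hST.symm] at hlim
  refine mul_ne_zero (hpos u hu y hyu) (hpos v hv 1 (by rw [map_one]; exact h1v)) ?_
  refine tendsto_nhds_unique_of_frequently_eq hlim tendsto_const_nhds (hχ.mono fun n hn => ?_)
  rw [← measure_empty (μ := normalizedHaar X)]
  congr 1
  rw [eq_empty_iff_forall_notMem]
  intro x hx
  simp only [mem_iInter, mem_preimage] at hx
  have h1 := hx S (by simp)
  have h2 := hx T (by simp)
  rw [if_pos rfl, mem_preimage, ← PontryaginDual.iterate_map_apply, hn,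
    PontryaginDual.iterate_map_apply] at h1
  rw [if_neg hST.symm] at h2
  exact Set.disjoint_left.mp huv h1 h2

end MixingCriterion

/-! ### The rational dual and its orbits. -/

section RationalDual

variable {X : Type*} [TopologicalSpace X] [CommGroup X]

/-- The character group of a connected group is torsion free. -/
theorem PontryaginDual.eq_one_of_pow_eq_one [ConnectedSpace X] {χ : PontryaginDual X} {n : ℕ}
    (hn : 0 < n) (h : χ ^ n = 1) : χ = 1 := by
  -- The values are `n`-th roots of unity, and a finite connected subset of the circle has at most
  -- one point.
  have hfin : (range χ).Finite := by
    refine Set.Finite.subset ((Polynomial.nthRootsFinset n (1 : ℂ)).finite_toSet.preimage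
      (f := fun z : Circle => (z : ℂ)) fun a _ b _ hab => Circle.ext hab) ?_
    rintro _ ⟨x, rfl⟩
    rw [mem_preimage, Finset.mem_coe, Polynomial.mem_nthRootsFinset hn]
    let e : PontryaginDual X →* Circle :=
      { toFun := fun ψ => ψ x, map_one' := rfl, map_mul' := fun _ _ => rfl }
    have h1 : (χ x) ^ n = 1 := by rw [← e.map_one, ← h, map_pow]; rfl
    rw [← Circle.coe_pow, h1, Circle.coe_one]
  have hsub : (range χ).Subsingleton := by
    by_contra hne
    exact (isPreconnected_range (map_continuous χ)).infinite_of_nontrivial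
      (Set.not_subsingleton_iff.mp hne) hfin
  ext x
  rw [hsub ⟨x, rfl⟩ ⟨1, rfl⟩, _root_.map_one]
  rfl

instance isLocalizedModule_ratDual : IsLocalizedModule (nonZeroDivisors ℤ)
    (TensorProduct.mk ℤ ℚ (Additive (PontryaginDual X)) 1) :=
  (isLocalizedModule_iff_isBaseChange (nonZeroDivisors ℤ) ℚ _).mpr
    (TensorProduct.isBaseChange ℤ (Additive (PontryaginDual X)) ℚ)

theorem ratDual_tmul_eq_zero [ConnectedSpace X] {m : Additive (PontryaginDual X)}
    (h : (1 : ℚ) ⊗ₜ[ℤ] m = 0) : m = 0 := by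
  obtain ⟨⟨c, hc⟩, hcm⟩ := (IsLocalizedModule.eq_zero_iff (nonZeroDivisors ℤ)
    (TensorProduct.mk ℤ ℚ (Additive (PontryaginDual X)) 1)).mp h
  have hc0 : c ≠ 0 := nonZeroDivisors.ne_zero hc
  have h1 : c.natAbs • m = 0 := by
    have h2 : c • m = 0 := hcm
    rcases Int.natAbs_eq c with h3 | h3
    · rw [h3] at h2
      simpa using h2
    · rw [h3] at h2
      simpa using h2
  exact congrArg Additive.ofMul (PontryaginDual.eq_one_of_pow_eq_one (Int.natAbs_pos.mpr hc0)
    (congrArg Additive.toMul h1))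

theorem charMap_pow_apply (T : X →ₜ* X) (χ : PontryaginDual X) (n : ℕ) :
    (charMap T ^ n) (Additive.ofMul χ) = Additive.ofMul ((PontryaginDual.map T)^[n] χ) := by
  induction n with
  | zero => rfl
  | succ n ih =>
    rw [pow_succ', Module.End.mul_apply, ih, Function.iterate_succ_apply']
    rfl

theorem hatMap_pow_tmul (T : X →ₜ* X) (m : Additive (PontryaginDual X)) (n : ℕ) :
    (hatMap T ^ n) ((1 : ℚ) ⊗ₜ[ℤ] m) = (1 : ℚ) ⊗ₜ[ℤ] ((charMap T ^ n) m) := by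
  rw [hatMap, ← LinearMap.baseChange_pow, LinearMap.baseChange_tmul]

theorem commute_charMap {S T : X →ₜ* X} (h : S.comp T = T.comp S) :
    Commute (charMap S) (charMap T) := by
  refine LinearMap.ext fun χ => congrArg Additive.ofMul (PontryaginDual.ext fun x => ?_)
  exact congrArg χ.toMul (DFunLike.congr_fun h x).symm

theorem commute_hatMap {S T : X →ₜ* X} (h : S.comp T = T.comp S) :
    Commute (hatMap S) (hatMap T) := by
  rw [commute_iff_eq, hatMap, hatMap, ← LinearMap.baseChange_mul, (commute_charMap h).eq,
    LinearMap.baseChange_mul]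

theorem pow_mul_apply_eq {R M : Type*} [Ring R] [AddCommGroup M] [Module R M] {A B : Module.End R M}
    (h : Commute A B) {l : ℕ} {w : M} (hw : (B ^ l) w = (A ^ l) w) (k : ℕ) :
    (B ^ (l * k)) w = (A ^ (l * k)) w := by
  induction k with
  | zero => simp
  | succ k ih =>
    rw [mul_add, mul_one, pow_add, pow_add, Module.End.mul_apply, hw, ← Module.End.mul_apply,
      ← (h.pow_pow l (l * k)).eq, Module.End.mul_apply, ih, ← Module.End.mul_apply,
      ← pow_add, ← pow_add, add_comm]

/-- A difference of powers of commuting `T̂`'s that is not injective is detected by a nontrivial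
character. -/
theorem exists_character_of_not_injective [ConnectedSpace X] {S T : X →ₜ* X}
    (h : S.comp T = T.comp S) {l : ℕ}
    (hl : ¬ Function.Injective (hatMap T ^ l - hatMap S ^ l)) :
    ∃ χ : PontryaginDual X, χ ≠ 1 ∧ ∀ k : ℕ,
      (PontryaginDual.map S)^[l * k] χ = (PontryaginDual.map T)^[l * k] χ := by
  rw [injective_iff_map_eq_zero] at hl
  push Not at hl
  obtain ⟨w, hw, hw0⟩ := hl
  -- Clearing denominators turns the kernel vector into an honest character.
  obtain ⟨⟨m, c⟩, hmc⟩ := IsLocalizedModule.surj (nonZeroDivisors ℤ)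
    (TensorProduct.mk ℤ ℚ (Additive (PontryaginDual X)) 1) w
  have hmc' : (c : ℤ) • w = (1 : ℚ) ⊗ₜ[ℤ] m := hmc
  have hm : m ≠ 0 := by
    rintro rfl
    rw [TensorProduct.tmul_zero, ← Int.cast_smul_eq_zsmul ℚ] at hmc'
    have hc0 : ((c : ℤ) : ℚ) ≠ 0 := by exact_mod_cast nonZeroDivisors.coe_ne_zero c
    exact hw0 ((smul_eq_zero.mp hmc').resolve_left hc0)
  have h1 : (charMap T ^ l) m = (charMap S ^ l) m := by
    rw [← sub_eq_zero]
    apply ratDual_tmul_eq_zero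
    rw [TensorProduct.tmul_sub, ← hatMap_pow_tmul, ← hatMap_pow_tmul, ← LinearMap.sub_apply,
      ← hmc', map_zsmul, hw, smul_zero]
  refine ⟨m.toMul, fun h0 => hm (congrArg Additive.ofMul h0), fun k => ?_⟩
  have h2 := pow_mul_apply_eq (commute_charMap h) h1 k
  have h3 : m = Additive.ofMul m.toMul := rfl
  rw [h3, charMap_pow_apply, charMap_pow_apply] at h2
  exact (congrArg Additive.toMul h2).symm

/-- If all differences of powers of commuting `T̂ i`'s are injective then product characters are
eventually nontrivial. -/
theorem eventually_prodCharacter_ne_one [ConnectedSpace X] [FiniteDimensional ℚ (RatDual X)]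
    {ι : Type*} [Fintype ι] {T : ι → X →ₜ* X} (hT : ∀ i, Function.Surjective (T i))
    (hcomm : ∀ i j, (T i).comp (T j) = (T j).comp (T i))
    (hinj : ∀ i j, i ≠ j → ∀ l : ℕ, 1 ≤ l →
      Function.Injective (hatMap (T j) ^ l - hatMap (T i) ^ l))
    {χ : ι → PontryaginDual X} (hχ : χ ≠ 1) : ∀ᶠ n in atTop, prodCharacter T χ n ≠ 1 := by
  by_contra hfreq
  rw [← Filter.Frequently] at hfreq
  apply hχ
  let v : ι → RatDual X := fun i => (1 : ℚ) ⊗ₜ[ℤ] Additive.ofMul (χ i)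
  choose u hu using fun i => isUnit_hatMap (T i) (hT i)
  have hsum : ∀ n, prodCharacter T χ n = 1 →
      ∑ i, ((u i : Module.End ℚ (RatDual X)) ^ n) (v i) = 0 := by
    intro n hn
    have h1 : ∑ i, (charMap (T i) ^ n) (Additive.ofMul (χ i)) = 0 := by
      simp only [charMap_pow_apply]
      exact congrArg Additive.ofMul hn
    simp only [v, hu, hatMap_pow_tmul]
    rw [← TensorProduct.tmul_sum, h1, TensorProduct.tmul_zero]
  obtain ⟨N, r, hN, hNr⟩ := Module.End.exists_progression_of_infinite u v
    ((Nat.frequently_atTop_iff_infinite.mp hfreq).mono fun n hn => hsum n hn)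
  simp only [hu] at hNr
  have hc : ∀ i j, Commute (hatMap (T i)) (hatMap (T j)) := fun i j => commute_hatMap (hcomm i j)
  -- Along the progression the operators are the `N`-th powers and the starting vectors are `T̂ i ^
  -- r (v i)`; the injectivity hypothesis is used with `l = N`.
  have h1 := Module.End.eq_zero_of_sum_pow_eq_zero (fun i => hatMap (T i) ^ N)
    (fun i j => (hc i j).pow_pow N N) Finset.univ (fun i _ j _ hij => hinj j i hij.symm N hN)
    (fun i => (hatMap (T i) ^ r) (v i)) fun k => by
      rw [← hNr k]
      refine Finset.sum_congr rfl fun i _ => ?_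
      rw [← Module.End.mul_apply, ← pow_mul, ← pow_add, add_comm]
  funext i
  have h2 : v i = 0 := by
    have h3 : Function.Injective (hatMap (T i) ^ r) := by
      rw [Module.End.coe_pow]
      refine Function.Injective.iterate ?_ r
      exact LinearMap.ker_eq_bot.mp
        ((LinearMap.isUnit_iff_ker_eq_bot _).mp (isUnit_hatMap (T i) (hT i)))
    exact h3 ((h1 i (Finset.mem_univ i)).trans (map_zero _).symm)
  exact congrArg Additive.toMul (ratDual_tmul_eq_zero h2)

end RationalDual

/-! ### The equivalence. -/

theorem mainTheorem4 (X : Type*) [TopologicalSpace X] [CommGroup X] [IsTopologicalGroup X]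
    [CompactSpace X] [T2Space X] [ConnectedSpace X] [MeasurableSpace X] [BorelSpace X]
    [DecidableEq (X →ₜ* X)] (hX : FiniteCoveringDim X)
    (s : ℕ) (hs : 2 ≤ s) (T : Fin s → (X →ₜ* X)) (hdist : Function.Injective T)
    (hsurj : ∀ i, Function.Surjective (T i))
    (hcomm : ∀ i j, (T i).comp (T j) = (T j).comp (T i)) :
    List.TFAE
      [IsMixing (Finset.univ.image T),
       ∀ i j, i ≠ j → IsMixing {T i, T j},
       ∀ i j, i ≠ j → ∀ ζ : ℂ, (∃ l : ℕ, 1 ≤ l ∧ ζ ^ l = 1) →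
         ¬ HasEigenvalueInvMul (hatMap (T i)) (hatMap (T j)) ζ] := by
  have := hX.finiteDimensional_ratDual
  have hiff : ∀ i j, (∀ ζ : ℂ, (∃ l : ℕ, 1 ≤ l ∧ ζ ^ l = 1) →
      ¬ HasEigenvalueInvMul (hatMap (T i)) (hatMap (T j)) ζ) ↔
      ∀ l : ℕ, 1 ≤ l → Function.Injective (hatMap (T j) ^ l - hatMap (T i) ^ l) := fun i j =>
    forall_not_hasEigenvalueInvMul_iff (isUnit_hatMap (T i) (hsurj i)) (commute_hatMap (hcomm i j))
  tfae_have 1 → 2 := by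
    intro h i j hij
    refine h.subset (fun γ hγ => ?_) ?_
    · rcases Finset.mem_insert.mp hγ with rfl | hγ
      · exact Finset.mem_image_of_mem T (Finset.mem_univ i)
      · rw [Finset.mem_singleton.mp hγ]
        exact Finset.mem_image_of_mem T (Finset.mem_univ j)
    · rw [Finset.card_pair (hdist.ne hij)]
      exact one_lt_two
  tfae_have 2 → 3 := by
    intro h i j hij
    rw [hiff]
    intro l hl
    by_contra hni
    obtain ⟨χ, hχ, hk⟩ := exists_character_of_not_injective (hcomm i j) hni
    refine hχ ((h i j hij).eq_one_of_frequently (hdist.ne hij) ?_)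
    rw [Filter.frequently_atTop]
    exact fun n => ⟨l * n, Nat.le_mul_of_pos_left n hl, hk n⟩
  tfae_have 3 → 1 := by
    intro h
    refine isMixing_of_eventually_ne_one hdist (by rw [Fintype.card_fin]; omega) hsurj
      fun χ hχ => eventually_prodCharacter_ne_one hsurj hcomm
        (fun i j hij => (hiff i j).mp (h i j hij)) hχ
  tfae_finish
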